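/- Let $d\ge 1$ and let $\Gamma$ be a set of decorations. A *pattern* in $\mathbb R^d$ is a finite set of decorated tiles $(a,c)$, where $c\in\Gamma$ and $a\subset\mathbb R^d$ is homeomorphic to the closed unit ball, such that distinct tiles have disjoint interiors; a *tiling* is a (not necessarily finite) set of tiles of this kind whose union is $\mathbb R^d$. (Undecorated patterns and tilings are the case where $\Gamma$ is a single point.) An *abstract pattern* is a class of patterns up to translation, and $P\subset Q$ for abstract patterns means that some representative of $P$ is a subset of some representative of $Q$. For a pattern $M$ let $s(M)$ be the union of its tiles, let $r_{\rm in}(M)$ be the largest radius of a closed ball contained in $s(M)$ and $r_{\rm out}(M)$ the smallest radius of a closed ball containing $s(M)$; these are defined on abstract patterns as well. A set $\mathcal P$ of abstract patterns is *admissible* if (i) $P\in\mathcal P$ and $Q\subset P$ imply $Q\in\mathcal P$; (ii) there are $0<r_{\min},r_{\max}<\infty$ with $r_{\min}\le r_{\rm in}(a)\le r_{\rm out}(a)\le r_{\max}$ for all tiles $a$ occurring in $\mathcal P$; (iii) for every pattern $\dot P$ with class in $\mathcal P$ and $0\in s(\dot P)$ and every $r>0$ there is a pattern $\dot Q\supset\dot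 P$ with class in $\mathcal P$ whose union $s(\dot Q)$ contains the closed ball of radius $r$ about $0$. It is *linearly repetitive* if there is $c>0$ such that every $P\in\mathcal P$ with $r_{\rm out}(P)\ge 1$ is contained in every $Q\in\mathcal P$ with $r_{\rm in}(Q)\ge c\, r_{\rm out}(P)$. Let $\Omega(\mathcal P)$ be the set of all tilings $T$ such that the classes of all finite subsets of $T$ belong to $\mathcal P$, with the topology induced by $$d(T,S)=\inf\{\epsilon>0:\ T\cap B(0,\tfrac1\epsilon)=(S+t)\cap B(0,\tfrac1\epsilon)\ \text{for some } t\in\mathbb R^d,\ \|t\|\le\epsilon\},$$ where $B(0,r)$ is the closed ball and $T\cap B=\{(a\cap B,c): (a,c)\in T,\ a\cap{\rm int}(B)\ne\emptyset\}$; that is, $U\subset\Omega(\mathcal P)$ is open iff for each $T\in U$ there is $\epsilon>0$ such that every $S\in\Omega(\mathcal P)$ with $d(T,S)<\epsilon$ lies in $U$. The group $\mathbb R^d$ acts on $\Omega(\mathcal P)$ by translation, $T\mapsto T+v$. **Theorem.** Let $\mathcal P$ be an admissible, linearly repetitive set of abstract patterns that contains at least one nonempty pattern. Then the dynamical system $(\Omega(\mathcal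 P),\mathbb R^d)$ is uniquely ergodic: there is exactly one translation invariant Borel probability measure $\mu$ on $\Omega(\mathcal P)$. Moreover, for every continuous $f:\Omega(\mathcal P)\to\mathbb R$, the function $f$ is $\mu$-integrable, the function $t\mapsto f(T-t)$ is integrable on every box $B$ for every $T\in\Omega(\mathcal P)$, and $$\frac1{|B|}\int_B f(T-t)\,dt\ \longrightarrow\ \int_{\Omega(\mathcal P)} f\,d\mu$$ uniformly in $T\in\Omega(\mathcal P)$ as the width $\omega(B)$ tends to infinity, where $B$ runs through the boxes $B=\prod_{j=1}^d[a_j,b_j]$, $a_j<b_j$, and $\omega(B)=\min_j(b_j-a_j)$. -/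

import Mathlib

open MeasureTheory Metric
open scoped Pointwise ENNReal

namespace LRTiling

/-- Euclidean space of dimension `d`. -/
abbrev E (d : ℕ) : Type := EuclideanSpace ℝ (Fin d)

/-- A tile shape: a subset of Euclidean space homeomorphic to the closed unit ball. -/
def IsTileShape {d : ℕ} (a : Set (E d)) : Prop :=
  Nonempty (a ≃ₜ closedBall (0 : E d) 1)

/-- A decorated tile: a subset of space together with a decoration from `Γ`.
The undecorated case is `Γ = Unit`. -/
abbrev DTile (d : ℕ) (Γ : Type*) := Set (E d) × Γ

/-- Translation of a decorated tile; the decoration is kept. -/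
def shiftTile {d : ℕ} {Γ : Type*} (v : E d) (m : DTile d Γ) : DTile d Γ := (v +ᵥ m.1, m.2)

/-- A set of decorated tiles whose underlying sets are homeomorphic to the closed unit ball
and pairwise disjoint up to their boundaries. -/
structure IsTileFamily {d : ℕ} {Γ : Type*} (M : Set (DTile d Γ)) : Prop where
  isTileShape : ∀ m ∈ M, IsTileShape m.1
  disjoint : M.Pairwise fun m n => Disjoint (interior m.1) (interior n.1)

/-- The union of the tiles of a set of tiles. -/
def support {d : ℕ} {Γ : Type*} (M : Set (DTile d Γ)) : Set (E d) := ⋃ m ∈ M, m.1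

/-- A (decorated) pattern is a finite family of tiles. -/
@[ext]
structure Pattern (d : ℕ) (Γ : Type*) where
  tiles : Set (DTile d Γ)
  finite : tiles.Finite
  isTileFamily : IsTileFamily tiles

/-- A (decorated) tiling is a family of tiles that covers the whole space. -/
@[ext]
structure Tiling (d : ℕ) (Γ : Type*) where
  tiles : Set (DTile d Γ)
  isTileFamily : IsTileFamily tiles
  cover : support tiles = Set.univ

/-! ### Translations -/

section Translation

variable {d : ℕ} {Γ : Type*}

theorem shiftTile_zero (m : DTile d Γ) : shiftTile 0 m = m := by
  simp [shiftTile]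

theorem shiftTile_add (v w : E d) (m : DTile d Γ) :
    shiftTile (v + w) m = shiftTile v (shiftTile w m) := by
  simp [shiftTile, add_vadd]

theorem shiftTiles_zero (M : Set (DTile d Γ)) : shiftTile 0 '' M = M := by
  simp [shiftTile_zero]

theorem shiftTiles_add (v w : E d) (M : Set (DTile d Γ)) :
    shiftTile (v + w) '' M = shiftTile v '' (shiftTile w '' M) := by
  rw [Set.image_image]
  exact Set.image_congr fun m _ => shiftTile_add v w m

theorem IsTileShape.vadd {a : Set (E d)} (h : IsTileShape a) (v : E d) :
    IsTileShape (v +ᵥ a) := by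
  obtain ⟨e⟩ := h
  exact ⟨((Homeomorph.vadd v).image a).symm.trans e⟩

theorem IsTileFamily.shift {M : Set (DTile d Γ)} (h : IsTileFamily M) (v : E d) :
    IsTileFamily (shiftTile v '' M) where
  isTileShape := by
    rintro _ ⟨m, hm, rfl⟩
    exact (h.isTileShape m hm).vadd v
  disjoint := by
    rintro _ ⟨m, hm, rfl⟩ _ ⟨n, hn, rfl⟩ hmn
    have hne : m ≠ n := fun e => hmn (by rw [e])
    have := h.disjoint hm hn hne
    simp only [shiftTile, interior_vadd]
    exact (Set.disjoint_image_iff (AddAction.injective v)).2 this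

theorem support_shift (v : E d) (M : Set (DTile d Γ)) :
    support (shiftTile v '' M) = v +ᵥ support M := by
  simp only [support, Set.biUnion_image, shiftTile, Set.vadd_set_iUnion]

/-- Translation of patterns. -/
instance : AddAction (E d) (Pattern d Γ) where
  vadd v P := ⟨shiftTile v '' P.tiles, P.finite.image _, P.isTileFamily.shift v⟩
  zero_vadd P := Pattern.ext (shiftTiles_zero P.tiles)
  add_vadd v w P := Pattern.ext (shiftTiles_add v w P.tiles)

/-- Translation of tilings, `v +ᵥ T = T + v`. -/
instance : AddAction (E d) (Tiling d Γ) where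
  vadd v T := ⟨shiftTile v '' T.tiles, T.isTileFamily.shift v, by
    rw [support_shift, T.cover, Set.vadd_set_univ]⟩
  zero_vadd T := Tiling.ext (shiftTiles_zero T.tiles)
  add_vadd v w T := Tiling.ext (shiftTiles_add v w T.tiles)

theorem Pattern.tiles_vadd (v : E d) (P : Pattern d Γ) :
    (v +ᵥ P).tiles = shiftTile v '' P.tiles := rfl

theorem Tiling.tiles_vadd (v : E d) (T : Tiling d Γ) :
    (v +ᵥ T).tiles = shiftTile v '' T.tiles := rfl

end Translation

/-! ### Inner and outer radius -/

section Radius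

variable {d : ℕ} {Γ : Type*}

/-- The largest radius of a closed ball contained in `A`. -/
noncomputable def innerRadius (A : Set (E d)) : ℝ :=
  sSup {r : ℝ | ∃ x : E d, closedBall x r ⊆ A}

/-- The smallest radius of a closed ball containing `A`. -/
noncomputable def outerRadius (A : Set (E d)) : ℝ :=
  sInf {r : ℝ | ∃ x : E d, A ⊆ closedBall x r}

theorem innerRadius_vadd (v : E d) (A : Set (E d)) : innerRadius (v +ᵥ A) = innerRadius A := by
  unfold innerRadius
  congr 1
  ext r
  constructor
  · rintro ⟨x, hx⟩
    refine ⟨-v +ᵥ x, ?_⟩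
    rw [← Metric.vadd_closedBall]
    exact (Set.vadd_set_subset_iff_subset_neg_vadd_set).2 (by simpa using hx)
  · rintro ⟨x, hx⟩
    refine ⟨v +ᵥ x, ?_⟩
    rw [← Metric.vadd_closedBall]
    exact Set.vadd_set_mono hx

theorem outerRadius_vadd (v : E d) (A : Set (E d)) : outerRadius (v +ᵥ A) = outerRadius A := by
  unfold outerRadius
  congr 1
  ext r
  constructor
  · rintro ⟨x, hx⟩
    refine ⟨-v +ᵥ x, ?_⟩
    rw [← Metric.vadd_closedBall]
    exact (Set.vadd_set_subset_iff_subset_neg_vadd_set).1 hx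
  · rintro ⟨x, hx⟩
    refine ⟨v +ᵥ x, ?_⟩
    rw [← Metric.vadd_closedBall]
    exact Set.vadd_set_mono hx

end Radius

/-! ### Abstract patterns -/

/-- Abstract patterns: classes of patterns up to translation. -/
abbrev AbstractPattern (d : ℕ) (Γ : Type*) : Type _ :=
  AddAction.orbitRel.Quotient (E d) (Pattern d Γ)

section Abstract

variable {d : ℕ} {Γ : Type*}

/-- The class of a pattern up to translation. -/
def Pattern.toAbstract (P : Pattern d Γ) : AbstractPattern d Γ :=
  Quotient.mk (AddAction.orbitRel (E d) (Pattern d Γ)) P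

theorem Pattern.toAbstract_vadd (v : E d) (P : Pattern d Γ) :
    (v +ᵥ P).toAbstract = P.toAbstract :=
  Quotient.sound ⟨v, rfl⟩

namespace AbstractPattern

/-- The inner radius of an abstract pattern. -/
noncomputable def rin (P : AbstractPattern d Γ) : ℝ :=
  Quotient.liftOn P (fun P' => innerRadius (support P'.tiles)) (by
    rintro _ b ⟨v, rfl⟩
    exact (congrArg innerRadius (support_shift v b.tiles)).trans (innerRadius_vadd v _))

/-- The outer radius of an abstract pattern. -/
noncomputable def rout (P : AbstractPattern d Γ) : ℝ :=
  Quotient.liftOn P (fun P' => outerRadius (support P'.tiles)) (by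
    rintro _ b ⟨v, rfl⟩
    exact (congrArg outerRadius (support_shift v b.tiles)).trans (outerRadius_vadd v _))

/-- `P` is contained in `Q` as an abstract pattern: some representative of `P` is a subpattern
of some representative of `Q`. -/
def IsSubpattern (P Q : AbstractPattern d Γ) : Prop :=
  ∃ P' Q' : Pattern d Γ, P'.toAbstract = P ∧ Q'.toAbstract = Q ∧ P'.tiles ⊆ Q'.tiles

end AbstractPattern

/-- Admissible sets of abstract patterns. -/
structure Admissible (Pset : Set (AbstractPattern d Γ)) : Prop where
  /-- closed under passing to subpatterns -/
  subpattern : ∀ P ∈ Pset, ∀ Q : AbstractPattern d Γ, Q.IsSubpattern P → Q ∈ Pset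
  /-- uniform bounds on the inner and outer radii of the tiles -/
  radii : ∃ rmin rmax : ℝ, 0 < rmin ∧ 0 < rmax ∧
    ∀ P : Pattern d Γ, P.toAbstract ∈ Pset → ∀ a ∈ P.tiles,
      rmin ≤ innerRadius a.1 ∧ innerRadius a.1 ≤ outerRadius a.1 ∧ outerRadius a.1 ≤ rmax
  /-- patterns over the origin extend to patterns covering any given ball about the origin -/
  extend : ∀ P : Pattern d Γ, P.toAbstract ∈ Pset → (0 : E d) ∈ support P.tiles →
    ∀ r : ℝ, 0 < r → ∃ Q : Pattern d Γ, Q.toAbstract ∈ Pset ∧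
      closedBall (0 : E d) r ⊆ support Q.tiles ∧ P.tiles ⊆ Q.tiles

/-- Linear repetitivity of a set of abstract patterns. -/
def LinearlyRepetitive (Pset : Set (AbstractPattern d Γ)) : Prop :=
  ∃ c : ℝ, 0 < c ∧ ∀ P ∈ Pset, 1 ≤ P.rout → ∀ Q ∈ Pset, c * P.rout ≤ Q.rin → P.IsSubpattern Q

/-! ### The tiling space -/

/-- The set of abstract patterns associated to a tiling: the classes of its subpatterns. -/
def Tiling.patterns (T : Tiling d Γ) : Set (AbstractPattern d Γ) :=
  {P | ∃ P' : Pattern d Γ, P'.toAbstract = P ∧ P'.tiles ⊆ T.tiles}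

theorem Tiling.patterns_vadd_subset (v : E d) (T : Tiling d Γ) :
    (v +ᵥ T).patterns ⊆ T.patterns := by
  rintro _ ⟨P, rfl, hP⟩
  refine ⟨-v +ᵥ P, Pattern.toAbstract_vadd _ _, ?_⟩
  rw [Pattern.tiles_vadd]
  refine (Set.image_mono hP).trans ?_
  rw [Tiling.tiles_vadd, ← shiftTiles_add, neg_add_cancel, shiftTiles_zero]

/-- The restriction `T ∩ B` of a tiling to a set `B`: the sets `m ∩ B` (with their decorations),
for the tiles `m` that meet the interior of `B`. -/
def Tiling.restrict (T : Tiling d Γ) (B : Set (E d)) : Set (DTile d Γ) :=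
  {p | ∃ m ∈ T.tiles, (m.1 ∩ interior B).Nonempty ∧ p = (m.1 ∩ B, m.2)}

/-- The distance of two tilings: the infimum of all `ε > 0` such that `T` and `S + t` agree on
the ball of radius `1 / ε` about the origin for some `t` with `‖t‖ ≤ ε`. (The value is taken in
`[0, ∞]`, so that the infimum of the empty set is `∞`.) -/
noncomputable def tilingDist (T S : Tiling d Γ) : ℝ≥0∞ :=
  ⨅ (ε : ℝ) (_ : 0 < ε ∧ ∃ t : E d, ‖t‖ ≤ ε ∧
      T.restrict (closedBall 0 (1 / ε)) = (t +ᵥ S).restrict (closedBall 0 (1 / ε))),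
    ENNReal.ofReal ε

/-- The space `Ω(Pset)` of all tilings associated to `Pset`. -/
def TilingSpace (Pset : Set (AbstractPattern d Γ)) : Type _ :=
  {T : Tiling d Γ // T.patterns ⊆ Pset}

variable {Pset : Set (AbstractPattern d Γ)}

/-- The topology on the tiling space induced by the distance: a set is open if and only if it
contains, with each of its points `T`, all `S` with `tilingDist T S < ε`, for some `ε > 0`. -/
instance : TopologicalSpace (TilingSpace Pset) where
  IsOpen U := ∀ T ∈ U, ∃ ε : ℝ≥0∞, 0 < ε ∧
    ∀ S : TilingSpace Pset, tilingDist T.1 S.1 < ε → S ∈ U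
  isOpen_univ := fun _ _ => ⟨1, one_pos, fun _ _ => Set.mem_univ _⟩
  isOpen_inter := by
    rintro U V hU hV T ⟨hTU, hTV⟩
    obtain ⟨ε, hε, h⟩ := hU T hTU
    obtain ⟨δ, hδ, h'⟩ := hV T hTV
    exact ⟨min ε δ, lt_min hε hδ, fun S hS =>
      ⟨h S (hS.trans_le (min_le_left _ _)), h' S (hS.trans_le (min_le_right _ _))⟩⟩
  isOpen_sUnion := by
    rintro Us hUs T ⟨U, hU, hTU⟩
    obtain ⟨ε, hε, h⟩ := hUs U hU T hTU
    exact ⟨ε, hε, fun S hS => ⟨U, hU, h S hS⟩⟩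

/-- The tiling space carries its Borel σ-algebra. -/
instance : MeasurableSpace (TilingSpace Pset) := borel _

instance : BorelSpace (TilingSpace Pset) := ⟨rfl⟩

/-- The action of Euclidean space on the tiling space by translation. -/
instance : AddAction (E d) (TilingSpace Pset) where
  vadd v T := ⟨v +ᵥ T.1, (Tiling.patterns_vadd_subset v T.1).trans T.2⟩
  zero_vadd T := Subtype.ext (zero_vadd (E d) T.1)
  add_vadd v w T := Subtype.ext (add_vadd v w T.1)

end Abstract

/-! ### Boxes -/

/-- A box in Euclidean space, given by the end points of its sides. -/
structure Box (d : ℕ) where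
  lower : Fin d → ℝ
  upper : Fin d → ℝ
  lower_lt_upper : ∀ j, lower j < upper j

/-- The box as a set of points. -/
def Box.toSet {d : ℕ} (B : Box d) : Set (E d) :=
  {x | ∀ j, B.lower j ≤ x j ∧ x j ≤ B.upper j}

/-- The width of a box: the minimum of its side lengths. -/
noncomputable def Box.width {d : ℕ} (B : Box d) : ℝ :=
  ⨅ j, (B.upper j - B.lower j)

end LRTiling

namespace LRTiling

open Filter Topology

/-! ### Uniform measures on boxes -/

namespace Box

variable {d : ℕ}

/-! The heart of the matter is that box averages of a continuous `f` converge to a constant,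
uniformly over the space. Let `M` and `m` be the best eventual upper and lower bounds for averages
over wide boxes, and suppose `δ = M - m > 0`. Some cube of large side `L` then has an average close
to `m`. By linear repetitivity the values of `f` seen in this cube recur, up to a small error,
within a distance proportional to `L` of every point, and shifting a cube by a small multiple of `L`
hardly changes its average. Hence, in any box of side a fixed multiple of `L`, a proportion `κ` of
the translated cubes has average at most `M - δ/2`. As `κ` does not depend on `L`, a large `L` keeps
all other averages below `M + κδ/4`, and averaging once more gives an eventual upper bound below
`M`, a contradiction. This is `exists_eventuallyAverageLE_lt`; `exists_boxAverage_tendsto` draws the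
conclusion, and `uniquelyErgodic_of_linearlyRecurrent` obtains the measure as a weak limit of
uniform measures on pieces of an orbit.

This needs a compact metrizable space with a continuous action. The relations `Near` generate a
uniformity, whose topology is that of `tilingDist` because the tiles have bounded diameter
(`TileBounds.isOpen_iff`), so no triangle inequality for `tilingDist` is needed. The space is
complete (`TileBounds.completeSpace`). By `TileBounds.exists_agree_vadd`, any tiling agrees on a
ball of radius `R` with a translate of any other one by a vector of length `O(R)`. This yields total
boundedness and, by uniform continuity of `f`, the recurrence used above
(`TileBounds.linearlyRecurrent`). -/

theorem toSet_eq_preimage (B : Box d) :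
    B.toSet = WithLp.ofLp ⁻¹' Set.Icc B.lower B.upper := by
  ext x
  simp [toSet, Pi.le_def, forall_and]

theorem measurableSet_toSet (B : Box d) : MeasurableSet B.toSet := by
  rw [toSet_eq_preimage]
  exact (PiLp.volume_preserving_ofLp (Fin d)).measurable measurableSet_Icc

theorem volume_toSet (B : Box d) :
    volume B.toSet = ∏ j, ENNReal.ofReal (B.upper j - B.lower j) := by
  rw [toSet_eq_preimage, (PiLp.volume_preserving_ofLp (Fin d)).measure_preimage
    measurableSet_Icc.nullMeasurableSet, Real.volume_Icc_pi]

theorem sub_pos (B : Box d) (j : Fin d) : 0 < B.upper j - B.lower j :=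
  _root_.sub_pos.2 (B.lower_lt_upper j)

theorem volume_real_toSet (B : Box d) :
    volume.real B.toSet = ∏ j, (B.upper j - B.lower j) := by
  rw [Measure.real, volume_toSet, ENNReal.toReal_prod]
  exact Finset.prod_congr rfl fun j _ => ENNReal.toReal_ofReal (B.sub_pos j).le

theorem volume_real_pos (B : Box d) : 0 < volume.real B.toSet := by
  rw [volume_real_toSet]
  exact Finset.prod_pos fun j _ => B.sub_pos j

theorem volume_ne_top (B : Box d) : volume B.toSet ≠ ∞ := by
  rw [volume_toSet]
  exact ENNReal.prod_ne_top fun j _ => ENNReal.ofReal_ne_top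

theorem volume_ne_zero (B : Box d) : volume B.toSet ≠ 0 := fun h => by
  have := B.volume_real_pos
  simp [Measure.real, h] at this

theorem width_le (B : Box d) (j : Fin d) : B.width ≤ B.upper j - B.lower j :=
  ciInf_le (Set.finite_range _).bddBelow j

theorem width_pos (hd : 1 ≤ d) (B : Box d) : 0 < B.width := by
  have : Nonempty (Fin d) := ⟨⟨0, hd⟩⟩
  obtain ⟨j, hj⟩ := exists_eq_ciInf_of_finite (f := fun j => B.upper j - B.lower j)
  rw [width, ← hj]
  exact B.sub_pos j

/-- The uniform probability measure on a box. -/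
noncomputable def unif (B : Box d) : Measure (E d) :=
  (volume.restrict B.toSet Set.univ)⁻¹ • volume.restrict B.toSet

instance (B : Box d) : IsProbabilityMeasure B.unif := by
  constructor
  rw [unif, Measure.smul_apply, smul_eq_mul]
  refine ENNReal.inv_mul_cancel ?_ ?_
  · simpa using B.volume_ne_zero
  · simpa using B.volume_ne_top

theorem integral_unif (B : Box d) (h : E d → ℝ) :
    ∫ t, h t ∂B.unif = (volume.real B.toSet)⁻¹ * ∫ t in B.toSet, h t := by
  rw [unif, integral_smul_measure]
  simp [Measure.real]

theorem ae_unif_mem (B : Box d) : ∀ᵐ t ∂B.unif, t ∈ B.toSet :=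
  Measure.ae_smul_measure (ae_restrict_mem B.measurableSet_toSet) _

/-- Translating a box by `t` changes it by a small proportion only. -/
theorem le_volume_real_inter_translate (hd : 1 ≤ d) (B : Box d) (t : E d) :
    volume.real B.toSet * (1 - d * ‖t‖ / B.width) ≤
      volume.real (B.toSet ∩ (fun s => s - t) ⁻¹' B.toSet) := by
  have hw := B.width_pos hd
  have hd' : (1 : ℝ) ≤ d := by exact_mod_cast hd
  -- A translation longer than the width makes the left side nonpositive, since `1 ≤ d`. Otherwise
  -- the intersection contains the box whose sides are shortened by `|t j|`, and Bernoulli's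
  -- inequality bounds its volume.
  rcases le_or_gt B.width ‖t‖ with h | h
  · refine le_trans ?_ measureReal_nonneg
    refine mul_nonpos_of_nonneg_of_nonpos measureReal_nonneg ?_
    rw [sub_nonpos, le_div_iff₀ hw]
    nlinarith [norm_nonneg t]
  have hj : ∀ j, |t j| ≤ ‖t‖ := fun j => PiLp.norm_apply_le t j
  let B' : Box d := ⟨fun j => max (B.lower j) (B.lower j + t j),
    fun j => min (B.upper j) (B.upper j + t j), fun j => by
      have h1 := B.width_le j
      have h2 := abs_le.1 (hj j)
      simp only [max_lt_iff, lt_min_iff]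
      refine ⟨⟨?_, ?_⟩, ?_, ?_⟩ <;> linarith⟩
  have hsub : B'.toSet ⊆ B.toSet ∩ (fun s => s - t) ⁻¹' B.toSet := by
    intro x hx
    refine ⟨fun j => ?_, fun j => ?_⟩
    · obtain ⟨h1, h2⟩ := hx j
      exact ⟨(le_max_left _ _).trans h1, h2.trans (min_le_left _ _)⟩
    · obtain ⟨h1, h2⟩ := hx j
      have h3 := (le_max_right _ _).trans h1
      have h4 := h2.trans (min_le_right _ _)
      simp only [PiLp.sub_apply]
      constructor <;> linarith
  refine le_trans ?_ (measureReal_mono hsub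
    (measure_ne_top_of_subset Set.inter_subset_left B.volume_ne_top))
  rw [volume_real_toSet, volume_real_toSet]
  have hq : ‖t‖ / B.width ≤ 1 := (div_le_one hw).2 h.le
  have hq0 : 0 ≤ ‖t‖ / B.width := by positivity
  calc (∏ j, (B.upper j - B.lower j)) * (1 - d * ‖t‖ / B.width)
      ≤ (∏ j, (B.upper j - B.lower j)) * (1 - ‖t‖ / B.width) ^ d := by
        refine mul_le_mul_of_nonneg_left ?_ (Finset.prod_nonneg fun j _ => (B.sub_pos j).le)
        have := one_add_mul_le_pow (a := -(‖t‖ / B.width)) (by linarith) d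
        rw [← sub_eq_add_neg] at this
        refine le_trans (le_of_eq ?_) this
        ring
    _ = ∏ j, (B.upper j - B.lower j) * (1 - ‖t‖ / B.width) := by
        rw [Finset.prod_mul_distrib, Finset.prod_const, Finset.card_univ, Fintype.card_fin]
    _ ≤ ∏ j, (B'.upper j - B'.lower j) := by
        refine Finset.prod_le_prod (fun j _ => mul_nonneg (B.sub_pos j).le (by linarith))
          fun j _ => ?_
        have h1 : ‖t‖ ≤ (B.upper j - B.lower j) * (‖t‖ / B.width) := by
          rw [mul_div_assoc', le_div_iff₀ hw, mul_comm]
          exact mul_le_mul_of_nonneg_right (B.width_le j) (norm_nonneg t)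
        have h2 : B'.upper j - B'.lower j = (B.upper j - B.lower j) - |t j| := by
          simp only [B']
          rcases le_total 0 (t j) with h0 | h0
          · rw [abs_of_nonneg h0, min_eq_left (by linarith), max_eq_right (by linarith)]
            ring
          · rw [abs_of_nonpos h0, min_eq_right (by linarith), max_eq_left (by linarith)]
            ring
        rw [h2]
        linarith [hj j]

/-- Averages over a box of a bounded function and of its translate are close. -/
theorem abs_integral_translate_sub_le (hd : 1 ≤ d) (B : Box d) {h : E d → ℝ}
    (hc : Continuous h) {C : ℝ} (hC : ∀ s, |h s| ≤ C) (t : E d) :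
    |(∫ s, h (s + t) ∂B.unif) - ∫ s, h s ∂B.unif| ≤ 2 * C * d * ‖t‖ / B.width := by
  set A := B.toSet with hA
  set A' := (fun s : E d => s - t) ⁻¹' A with hA'
  have mA : MeasurableSet A := B.measurableSet_toSet
  have mp : MeasurePreserving (fun s : E d => s - t) volume volume :=
    measurePreserving_sub_right volume t
  have mA' : MeasurableSet A' := mp.measurable mA
  have fA : volume A ≠ ∞ := B.volume_ne_top
  have vA' : volume A' = volume A := mp.measure_preimage mA.nullMeasurableSet
  have fA' : volume A' ≠ ∞ := vA' ▸ fA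
  have hshift : ∫ s in A, h (s + t) = ∫ s in A', h s := by
    have := mp.setIntegral_preimage_emb (MeasurableEquiv.subRight t).measurableEmbedding
      (fun s => h (s + t)) A
    rw [← this]
    simp [hA']
  have hint : ∀ S : Set (E d), volume S ≠ ∞ → IntegrableOn h S volume := fun S hS => by
    have : IsFiniteMeasure (volume.restrict S) := ⟨by simpa using hS.lt_top⟩
    exact Integrable.of_bound hc.aestronglyMeasurable C (ae_of_all _ hC)
  have e1 := integral_inter_add_sdiff mA (hint A' fA')
  have e2 := integral_inter_add_sdiff mA' (hint A fA)
  rw [Set.inter_comm A' A] at e1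
  have b1 : |∫ s in A' \ A, h s| ≤ C * volume.real (A' \ A) := by
    rw [← Real.norm_eq_abs]
    exact norm_setIntegral_le_of_norm_le_const
        (measure_lt_top_of_subset Set.sdiff_subset fA') fun s _ => hC s
  have b2 : |∫ s in A \ A', h s| ≤ C * volume.real (A \ A') := by
    rw [← Real.norm_eq_abs]
    exact norm_setIntegral_le_of_norm_le_const
        (measure_lt_top_of_subset Set.sdiff_subset fA) fun s _ => hC s
  have v1 : volume.real (A ∩ A') + volume.real (A \ A') = volume.real A :=
    measureReal_inter_add_sdiff mA' fA
  have v2 : volume.real (A ∩ A') + volume.real (A' \ A) = volume.real A := by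
    rw [Set.inter_comm, measureReal_inter_add_sdiff mA fA']
    simp [Measure.real, vA']
  have v3 := B.le_volume_real_inter_translate hd t
  have vpos := B.volume_real_pos
  have hC0 : 0 ≤ C := (abs_nonneg _).trans (hC 0)
  rw [integral_unif, integral_unif, hshift, ← mul_sub, abs_mul, abs_of_pos (inv_pos.2 vpos),
    inv_mul_le_iff₀ vpos]
  -- The integrals over the common part cancel; each half of the symmetric difference contributes
  -- one of the two terms in the factor `2`.
  calc |(∫ s in A', h s) - ∫ s in A, h s| = |(∫ s in A' \ A, h s) - ∫ s in A \ A', h s| := by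
        rw [← e1, ← e2]; congr 1; ring
    _ ≤ C * volume.real (A' \ A) + C * volume.real (A \ A') :=
        (abs_sub _ _).trans (add_le_add b1 b2)
    _ ≤ C * (volume.real A * (d * ‖t‖ / B.width)) + C * (volume.real A * (d * ‖t‖ / B.width)) := by
        rw [← hA, ← hA'] at v3
        gcongr <;> linarith
    _ = volume.real A * (2 * C * d * ‖t‖ / B.width) := by ring

end Box

/-! ### Cubes and bounds on boxes -/

namespace Box

variable {d : ℕ}

theorem exists_norm_le (B : Box d) : ∃ D, ∀ t ∈ B.toSet, ‖t‖ ≤ D := by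
  have : IsCompact B.toSet := by
    rw [toSet_eq_preimage]
    exact (EuclideanSpace.equiv (Fin d) ℝ).toHomeomorph.isCompact_preimage.2 isCompact_Icc
  exact this.isBounded.exists_norm_le

/-- The cube with given lower corner and side length. -/
def cube (x : Fin d → ℝ) {L : ℝ} (hL : 0 < L) : Box d where
  lower := x
  upper j := x j + L
  lower_lt_upper j := by linarith

theorem width_cube (hd : 1 ≤ d) (x : Fin d → ℝ) {L : ℝ} (hL : 0 < L) :
    (cube x hL).width = L := by
  have : Nonempty (Fin d) := ⟨⟨0, hd⟩⟩
  simp [width, cube]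

theorem volume_real_cube (x : Fin d → ℝ) {L : ℝ} (hL : 0 < L) :
    volume.real (cube x hL).toSet = L ^ d := by
  rw [volume_real_toSet]
  simp [cube]

theorem unif_real_of_subset {B : Box d} {W : Set (E d)} (hW : MeasurableSet W)
    (h : W ⊆ B.toSet) : B.unif.real W = volume.real W / volume.real B.toSet := by
  rw [unif, measureReal_ennreal_smul_apply, measureReal_restrict_apply hW,
    Set.inter_eq_left.2 h, Measure.restrict_apply_univ, ENNReal.toReal_inv, div_eq_inv_mul]
  rfl

end Box

theorem norm_le_of_forall_abs_le {d : ℕ} (hd : 1 ≤ d) {t : E d} {L : ℝ} (hL : 0 ≤ L)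
    (h : ∀ j, |t j| ≤ L) : ‖t‖ ≤ d * L := by
  have hd' : (1 : ℝ) ≤ d := by exact_mod_cast hd
  rw [EuclideanSpace.norm_eq]
  refine Real.sqrt_le_iff.2 ⟨by positivity, ?_⟩
  calc ∑ j, ‖t j‖ ^ 2 ≤ ∑ _j : Fin d, L ^ 2 :=
        Finset.sum_le_sum fun j _ => pow_le_pow_left₀ (norm_nonneg _) (h j) 2
    _ = d * L ^ 2 := by simp
    _ ≤ (d * L) ^ 2 := by nlinarith [sq_nonneg L, mul_nonneg (sq_nonneg L) (by linarith : (0:ℝ) ≤ d)]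

/-! ### Averages of continuous functions over boxes -/

/-- The average of `f` over the part of the orbit of `T` given by the box `B`. -/
noncomputable def boxAverage {d : ℕ} {X : Type*} [AddAction (E d) X] (B : Box d) (f : X → ℝ)
    (T : X) : ℝ :=
  ∫ t, f (-t +ᵥ T) ∂B.unif

theorem boxAverage_neg {d : ℕ} {X : Type*} [AddAction (E d) X] (B : Box d) (f : X → ℝ) (T : X) :
    boxAverage B (fun S => -f S) T = -boxAverage B f T :=
  integral_neg _

section Average

variable {d : ℕ} {X : Type*} [TopologicalSpace X] [AddAction (E d) X] [ContinuousVAdd (E d) X]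
  {f : X → ℝ} {C : ℝ}

theorem continuous_orbit (hf : Continuous f) (T : X) : Continuous fun t : E d => f (-t +ᵥ T) :=
  hf.comp (continuous_neg.vadd continuous_const)

theorem integrable_orbit (hf : Continuous f) (hC : ∀ T, |f T| ≤ C) (p : Measure (E d))
    [IsFiniteMeasure p] (T : X) : Integrable (fun t : E d => f (-t +ᵥ T)) p :=
  Integrable.of_bound (continuous_orbit hf T).aestronglyMeasurable C (ae_of_all _ fun _ => hC _)

theorem boxAverage_le (hf : Continuous f) (hC : ∀ T, |f T| ≤ C) {a : ℝ} (h : ∀ T, f T ≤ a)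
    (B : Box d) (T : X) : boxAverage B f T ≤ a := by
  have := integral_mono (integrable_orbit hf hC B.unif T) (integrable_const a) fun t => h _
  simpa [boxAverage] using this

theorem abs_boxAverage_le (hf : Continuous f) (hC : ∀ T, |f T| ≤ C) (B : Box d) (T : X) :
    |boxAverage B f T| ≤ C := by
  refine abs_le.2 ⟨?_, boxAverage_le hf hC (fun T => (abs_le.1 (hC T)).2) B T⟩
  have := boxAverage_le (f := fun S => -f S) (a := C) hf.neg (by simpa using hC)
    (fun T => by linarith [(abs_le.1 (hC T)).1]) B T
  rw [boxAverage_neg] at this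
  linarith

theorem continuous_boxAverage [FirstCountableTopology X] (hf : Continuous f)
    (hC : ∀ T, |f T| ≤ C) (B : Box d) : Continuous (boxAverage B f) :=
  continuous_of_dominated (bound := fun _ => C)
    (fun T => (continuous_orbit hf T).aestronglyMeasurable)
    (fun _ => ae_of_all _ fun _ => hC _) (integrable_const C)
    (ae_of_all _ fun t => hf.comp (continuous_const_vadd (-t)))

/-- Fubini, together with commutativity of the translation group. -/
theorem boxAverage_comm (hf : Continuous f) (hC : ∀ T, |f T| ≤ C) (B B' : Box d) (T : X) :
    boxAverage B (boxAverage B' f) T = ∫ t, boxAverage B f (-t +ᵥ T) ∂B'.unif := by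
  have hc : Continuous (Function.uncurry fun s t : E d => f (-t +ᵥ (-s +ᵥ T))) :=
    hf.comp (continuous_snd.neg.vadd (continuous_fst.neg.vadd continuous_const))
  have := integral_integral_swap (μ := B.unif) (ν := B'.unif)
    (f := fun s t : E d => f (-t +ᵥ (-s +ᵥ T)))
    (Integrable.of_bound hc.aestronglyMeasurable C (ae_of_all _ fun _ => hC _))
  unfold boxAverage
  rw [this]
  refine integral_congr_ae (ae_of_all _ fun t => integral_congr_ae (ae_of_all _ fun s => ?_))
  simp only [vadd_vadd, add_comm]

/-- Moving the point along its orbit amounts to moving the box, so averages over a wide box vary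
slowly along orbits. -/
theorem abs_boxAverage_vadd_sub_le (hd : 1 ≤ d) (hf : Continuous f) (hC : ∀ T, |f T| ≤ C)
    (B : Box d) (T : X) (t : E d) :
    |boxAverage B f (-t +ᵥ T) - boxAverage B f T| ≤ 2 * C * d * ‖t‖ / B.width := by
  have := B.abs_integral_translate_sub_le hd (continuous_orbit hf T) (fun s => hC _) t
  refine le_trans (le_of_eq ?_) this
  unfold boxAverage
  congr 3
  ext s
  rw [vadd_vadd, neg_add]

/-- A function and its averages over a fixed box have asymptotically the same averages. -/
theorem exists_abs_boxAverage_boxAverage_sub_le (hd : 1 ≤ d) (hf : Continuous f)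
    (hC : ∀ T, |f T| ≤ C) (B' : Box d) {ε : ℝ} (hε : 0 < ε) :
    ∃ R : ℝ, ∀ B : Box d, R ≤ B.width → ∀ T : X,
      |boxAverage B (boxAverage B' f) T - boxAverage B f T| ≤ ε := by
  obtain ⟨D, hD⟩ := B'.exists_norm_le
  refine ⟨2 * C * d * D / ε, fun B hB T => ?_⟩
  have hC0 : 0 ≤ C := (abs_nonneg _).trans (hC T)
  have hw := B.width_pos hd
  -- After the swap the double average is a mean, over `t` in the fixed bounded box `B'`, of
  -- averages over `B` at translated points; each differs little from the untranslated one when `B`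
  -- is wide.
  rw [boxAverage_comm hf hC]
  have hconst : boxAverage B f T = ∫ _t, boxAverage B f T ∂B'.unif := by simp
  have hint : Integrable (fun t : E d => boxAverage B f (-t +ᵥ T)) B'.unif := by
    refine Integrable.of_bound (Continuous.aestronglyMeasurable ?_) C
      (ae_of_all _ fun _ => abs_boxAverage_le hf hC _ _)
    refine continuous_of_dominated (bound := fun _ => C)
      (fun t => (continuous_orbit hf _).aestronglyMeasurable)
      (fun t => ae_of_all _ fun t => hC _) (integrable_const C) (ae_of_all _ fun s => ?_)
    exact (continuous_orbit hf (T := T)).comp (f := fun t : E d => s + t) (by fun_prop) |>.congr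
      fun t => by simp [vadd_vadd, add_comm]
  rw [hconst, ← integral_sub hint (integrable_const _)]
  have := norm_integral_le_of_norm_le_const (μ := B'.unif) (C := ε)
    (f := fun t : E d => boxAverage B f (-t +ᵥ T) - boxAverage B f T) ?_
  · simpa using this
  · filter_upwards [B'.ae_unif_mem] with t ht
    refine (abs_boxAverage_vadd_sub_le hd hf hC B T t).trans ?_
    rw [div_le_iff₀ hw]
    rw [div_le_iff₀ hε] at hB
    have : 2 * C * d * ‖t‖ ≤ 2 * C * d * D := by gcongr; exact hD t ht
    linarith

end Average

/-! ### Uniform convergence of averages -/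

section Convergence

variable {d : ℕ} {X : Type*} [AddAction (E d) X]

/-- The averages of `f` over all sufficiently wide boxes are at most `a`. -/
def EventuallyAverageLE (f : X → ℝ) (a : ℝ) : Prop :=
  ∃ R : ℝ, ∀ B : Box d, R ≤ B.width → ∀ T : X, boxAverage B f T ≤ a

/-- The averages of `f` over all sufficiently wide boxes are at least `a`. -/
def EventuallyAverageGE (f : X → ℝ) (a : ℝ) : Prop :=
  ∃ R : ℝ, ∀ B : Box d, R ≤ B.width → ∀ T : X, a ≤ boxAverage B f T

/-- Up to a given error, the values of a continuous function on a large piece of an orbit, of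
radius `L` say, reappear in each orbit within a distance of order `L`. -/
def LinearlyRecurrent (d : ℕ) (X : Type*) [TopologicalSpace X] [AddAction (E d) X] : Prop :=
  ∃ C : ℝ, 0 ≤ C ∧ ∀ f : X → ℝ, Continuous f → ∀ ε : ℝ, 0 < ε → ∃ R : ℝ, ∀ L : ℝ, R ≤ L →
    ∀ T S : X, ∃ t : E d, ‖t‖ ≤ C * L ∧
      ∀ v : E d, ‖v‖ ≤ L → |f (v +ᵥ T) - f (v +ᵥ (t +ᵥ S))| ≤ ε

variable [TopologicalSpace X] [ContinuousVAdd (E d) X] [FirstCountableTopology X]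

/-- The improvement step: while the lower bound stays below the upper one, the recurrence of low
averages with positive frequency lowers the upper bound. The assumption `1 ≤ C` only makes division
by `C` safe. -/
theorem exists_eventuallyAverageLE_lt (hd : 1 ≤ d) (hLR : LinearlyRecurrent d X) {f : X → ℝ}
    (hf : Continuous f) {C : ℝ} (hC1 : 1 ≤ C) (hC : ∀ T, |f T| ≤ C) {m M : ℝ} (hmM : m < M)
    (hM : ∀ ε > 0, EventuallyAverageLE (d := d) f (M + ε))
    (hm : ∀ ε > 0, ¬ EventuallyAverageGE (d := d) f (m + ε)) :
    ∃ κ > 0, EventuallyAverageLE (d := d) f (M - κ) := by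
  have hd0 : (1 : ℝ) ≤ d := by exact_mod_cast hd
  obtain ⟨δ, hδ⟩ : ∃ δ, δ = M - m := ⟨_, rfl⟩
  have hδ0 : 0 < δ := by linarith
  obtain ⟨C₁, hC₁, hrep⟩ := hLR
  obtain ⟨R₀, hR₀⟩ := hrep f hf (δ / 8) (by positivity)
  -- Shifts within a cube of side `η * L` have length at most `d * η * L` and so change averages
  -- over `Q` by at most `2 * C * d ^ 2 * η = δ / 8`. With `K`, that cube fits into `[-K L, K L]^d`,
  -- and `κ` is the ratio of the two volumes. All three are fixed before `L`, which lets the excess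
  -- over `M` be chosen as `κ * δ / 4`.
  obtain ⟨η, hη⟩ : ∃ η, η = δ / (16 * C * d ^ 2) := ⟨_, rfl⟩
  have hη0 : 0 < η := by rw [hη]; positivity
  obtain ⟨K, hK⟩ : ∃ K, K = C₁ * d + η := ⟨_, rfl⟩
  have hK0 : 0 < K := by rw [hK]; positivity
  obtain ⟨κ, hκ⟩ : ∃ κ, κ = (η / (2 * K)) ^ d := ⟨_, rfl⟩
  have hκ0 : 0 < κ := by rw [hκ]; positivity
  obtain ⟨R₁, hR₁⟩ := hM (κ * δ / 4) (by positivity)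
  obtain ⟨L, hL⟩ : ∃ L, L = max (max R₀ R₁) 1 := ⟨_, rfl⟩
  have hL0 : 0 < L := by rw [hL]; exact lt_max_of_lt_right one_pos
  have hLR₀ : R₀ ≤ L := by rw [hL]; exact (le_max_left _ _).trans (le_max_left _ _)
  have hLR₁ : R₁ ≤ L := by rw [hL]; exact (le_max_right _ _).trans (le_max_left _ _)
  obtain ⟨Q, hQ⟩ : ∃ Q : Box d, Q = Box.cube 0 hL0 := ⟨_, rfl⟩
  have hQw : Q.width = L := by rw [hQ, Box.width_cube hd]
  have hQn : ∀ v ∈ Q.toSet, ‖v‖ ≤ d * L := by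
    intro v hv
    refine norm_le_of_forall_abs_le hd hL0.le fun j => ?_
    have := hv j
    rw [hQ] at this
    simp only [Box.cube, Pi.zero_apply, zero_add] at this
    exact abs_le.2 ⟨by linarith, this.2⟩
  have hgle : ∀ T, boxAverage Q f T ≤ M + κ * δ / 4 := hR₁ Q (hLR₁.trans hQw.ge)
  have hgc : Continuous (boxAverage Q f) := continuous_boxAverage hf hC Q
  have hgC : ∀ T, |boxAverage Q f T| ≤ C := abs_boxAverage_le hf hC Q
  -- If all averages over `Q` were at least `m + δ / 4`, then averaging them over wide boxes would
  -- make `m + δ / 8` an eventual lower bound for `f`.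
  obtain ⟨T, hT⟩ : ∃ T, boxAverage Q f T < m + δ / 4 := by
    by_contra! hcon
    refine hm (δ / 8) (by positivity) ?_
    obtain ⟨R, hR⟩ := exists_abs_boxAverage_boxAverage_sub_le hd hf hC Q
      (ε := δ / 8) (by positivity)
    refine ⟨R, fun B hB S => ?_⟩
    have h1 := (abs_le.1 (hR B hB S)).2
    have h2 := boxAverage_le (f := fun S => -boxAverage Q f S) hgc.neg (by simpa using hgC)
      (a := -(m + δ / 4)) (fun S => by linarith [hcon S]) B S
    rw [boxAverage_neg] at h2
    linarith
  have hKL : 0 < 2 * K * L := by positivity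
  obtain ⟨Q', hQ'⟩ : ∃ Q' : Box d, Q' = Box.cube (fun _ => -(K * L)) hKL := ⟨_, rfl⟩
  have key : ∀ S, boxAverage Q' (boxAverage Q f) S ≤ M - κ * δ / 4 := by
    intro S
    obtain ⟨t, ht, hclose⟩ := hR₀ (d * L) (hLR₀.trans (by nlinarith)) T S
    have hg1 : boxAverage Q f (t +ᵥ S) ≤ m + 3 * δ / 8 := by
      have : boxAverage Q f (t +ᵥ S) ≤ ∫ v, (f (-v +ᵥ T) + δ / 8) ∂Q.unif := by
        refine integral_mono_ae (integrable_orbit hf hC _ _)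
          ((integrable_orbit hf hC _ _).add (integrable_const _)) ?_
        filter_upwards [Q.ae_unif_mem] with v hv
        have := (abs_le.1 (hclose (-v) (by rw [norm_neg]; exact hQn v hv))).1
        linarith
      rw [integral_add (integrable_orbit hf hC _ _) (integrable_const _)] at this
      simp only [integral_const, probReal_univ, one_smul] at this
      change _ ≤ boxAverage Q f T + _ at this
      linarith
    have hηL : 0 < η * L := by positivity
    -- The corner is `-t` because averages use `-u +ᵥ S`: the choice `u = -t` gives the point `t +ᵥ
    -- S`, where the low average occurs.
    obtain ⟨W, hW⟩ : ∃ W : Box d, W = Box.cube (fun j => -t j) hηL := ⟨_, rfl⟩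
    have hg2 : ∀ u ∈ W.toSet, boxAverage Q f (-u +ᵥ S) ≤ M - δ / 2 := by
      intro u hu
      have hn : ‖u + t‖ ≤ d * (η * L) := by
        refine norm_le_of_forall_abs_le hd hηL.le fun j => ?_
        have := hu j
        rw [hW] at this
        simp only [Box.cube] at this
        rw [PiLp.add_apply]
        exact abs_le.2 ⟨by linarith, by linarith⟩
      have h1 := abs_boxAverage_vadd_sub_le hd hf hC Q (t +ᵥ S) (u + t)
      rw [vadd_vadd, neg_add, neg_add_cancel_right, hQw] at h1
      have h2 : 2 * C * d * ‖u + t‖ / L ≤ δ / 8 := by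
        rw [div_le_iff₀ hL0]
        calc 2 * C * d * ‖u + t‖ ≤ 2 * C * d * (d * (η * L)) := by gcongr
          _ = δ / 8 * L := by rw [hη]; field_simp; ring
      have h3 := (abs_le.1 (h1.trans h2)).2
      linarith
    have hWQ : W.toSet ⊆ Q'.toSet := by
      intro u hu j
      have h1 := hu j
      have h2 := abs_le.1 ((PiLp.norm_apply_le t j).trans ht)
      rw [hW] at h1
      rw [hQ']
      simp only [Box.cube] at h1 ⊢
      have h3 : K * L = C₁ * (d * L) + η * L := by rw [hK]; ring
      constructor <;> linarith
    have hμW : Q'.unif.real W.toSet = κ := by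
      rw [Box.unif_real_of_subset W.measurableSet_toSet hWQ, hW, hQ', Box.volume_real_cube,
        Box.volume_real_cube, hκ, ← div_pow]
      congr 1
      field_simp
    have hle : boxAverage Q' (boxAverage Q f) S ≤
        ∫ u, ((M + κ * δ / 4) - W.toSet.indicator (fun _ => δ / 2) u) ∂Q'.unif := by
      refine integral_mono_ae (integrable_orbit hgc hgC _ _)
        ((integrable_const _).sub ((integrable_const _).indicator W.measurableSet_toSet))
        (ae_of_all _ fun u => ?_)
      by_cases hu : u ∈ W.toSet
      · have := hg2 u hu
        have : 0 ≤ κ * δ / 4 := by positivity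
        simp only [Set.indicator_of_mem hu]
        linarith
      · simpa only [Set.indicator_of_notMem hu, sub_zero] using hgle _
    rw [integral_sub (integrable_const _)
      ((integrable_const _).indicator W.measurableSet_toSet),
      integral_indicator_const _ W.measurableSet_toSet, hμW] at hle
    simp only [integral_const, probReal_univ, smul_eq_mul] at hle
    linarith
  -- Passing from `f` to its averages over `Q`, and from these to their averages over `Q'`, costs `κ
  -- * δ / 16` each; half of the gain `κ * δ / 4` survives.
  obtain ⟨R, hR⟩ := exists_abs_boxAverage_boxAverage_sub_le hd hf hC Q
    (ε := κ * δ / 16) (by positivity)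
  obtain ⟨R', hR'⟩ := exists_abs_boxAverage_boxAverage_sub_le hd hgc hgC Q'
    (ε := κ * δ / 16) (by positivity)
  refine ⟨κ * δ / 8, by positivity, max R R', fun B hB S => ?_⟩
  have h1 := (abs_le.1 (hR B ((le_max_left _ _).trans hB) S)).1
  have h2 := (abs_le.1 (hR' B ((le_max_right _ _).trans hB) S)).1
  have h3 := boxAverage_le (continuous_boxAverage hgc hgC Q') (abs_boxAverage_le hgc hgC Q')
    key B S
  linarith

/-- In a linearly recurrent system, the averages of a continuous function over boxes converge
uniformly to a constant. -/
theorem exists_boxAverage_tendsto [Nonempty X] (hd : 1 ≤ d) (hLR : LinearlyRecurrent d X)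
    {f : X → ℝ} (hf : Continuous f) {C : ℝ} (hC : ∀ T, |f T| ≤ C) :
    ∃ l : ℝ, ∀ ε : ℝ, 0 < ε → ∃ R : ℝ, ∀ B : Box d, R ≤ B.width → ∀ T : X,
      |boxAverage B f T - l| ≤ ε := by
  wlog hC1 : 1 ≤ C generalizing C
  · exact this (C := max C 1) (fun T => (hC T).trans (le_max_left _ _)) (le_max_right _ _)
  obtain ⟨T₀⟩ := ‹Nonempty X›
  have hbox : ∀ R, ∃ B : Box d, R ≤ B.width := fun R =>
    ⟨Box.cube 0 (lt_max_of_lt_right one_pos : 0 < max R 1), by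
      rw [Box.width_cube hd]; exact le_max_left _ _⟩
  have hne : {a | EventuallyAverageLE (d := d) f a}.Nonempty :=
    ⟨C, 0, fun B _ T => (abs_le.1 (abs_boxAverage_le hf hC B T)).2⟩
  have hne' : {a | EventuallyAverageGE (d := d) f a}.Nonempty :=
    ⟨-C, 0, fun B _ T => (abs_le.1 (abs_boxAverage_le hf hC B T)).1⟩
  have hbdd : BddBelow {a | EventuallyAverageLE (d := d) f a} := by
    refine ⟨-C, fun a ⟨R, hR⟩ => ?_⟩
    obtain ⟨B, hB⟩ := hbox R
    exact (abs_le.1 (abs_boxAverage_le hf hC B T₀)).1.trans (hR B hB T₀)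
  have hbdd' : BddAbove {a | EventuallyAverageGE (d := d) f a} := by
    refine ⟨C, fun a ⟨R, hR⟩ => ?_⟩
    obtain ⟨B, hB⟩ := hbox R
    exact (hR B hB T₀).trans (abs_le.1 (abs_boxAverage_le hf hC B T₀)).2
  set M := sInf {a | EventuallyAverageLE (d := d) f a} with hM
  set m := sSup {a | EventuallyAverageGE (d := d) f a} with hm
  have hM1 : ∀ ε > 0, EventuallyAverageLE (d := d) f (M + ε) := by
    intro ε hε
    obtain ⟨a, ⟨R, hR⟩, ha⟩ := exists_lt_of_csInf_lt hne (lt_add_of_pos_right M hε)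
    exact ⟨R, fun B hB T => (hR B hB T).trans ha.le⟩
  have hm1 : ∀ ε > 0, EventuallyAverageGE (d := d) f (m - ε) := by
    intro ε hε
    obtain ⟨a, ⟨R, hR⟩, ha⟩ := exists_lt_of_lt_csSup hne' (sub_lt_self m hε)
    exact ⟨R, fun B hB T => ha.le.trans (hR B hB T)⟩
  -- Only this inequality is needed: `M + ε` and `m - ε ≥ M - ε` are then eventual upper and lower
  -- bounds.
  have hMm : M ≤ m := by
    by_contra! hlt
    obtain ⟨κ, hκ, h⟩ := exists_eventuallyAverageLE_lt hd hLR hf hC1 hC hlt hM1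
      fun ε hε h => by linarith [le_csSup hbdd' h]
    linarith [csInf_le hbdd h]
  refine ⟨M, fun ε hε => ?_⟩
  obtain ⟨R, hR⟩ := hM1 ε hε
  obtain ⟨R', hR'⟩ := hm1 ε hε
  refine ⟨max R R', fun B hB T => abs_le.2 ⟨?_, ?_⟩⟩
  · linarith [hR' B ((le_max_right _ _).trans hB) T]
  · linarith [hR B ((le_max_left _ _).trans hB) T]

end Convergence

/-! ### Unique ergodicity -/

theorem exists_abs_le_of_continuous {X : Type*} [TopologicalSpace X] [CompactSpace X]
    {f : X → ℝ} (hf : Continuous f) :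
    ∃ C, ∀ T, |f T| ≤ C := by
  obtain ⟨C, hC⟩ := isCompact_univ.exists_bound_of_continuousOn hf.continuousOn
  exact ⟨C, fun T => hC T trivial⟩

theorem integrable_of_continuous {X : Type*} [TopologicalSpace X] [CompactSpace X]
    [MeasurableSpace X] [OpensMeasurableSpace X] {f : X → ℝ} (hf : Continuous f) (μ : Measure X)
    [IsFiniteMeasure μ] : Integrable f μ := by
  obtain ⟨C, hC⟩ := exists_abs_le_of_continuous hf
  exact Integrable.of_bound hf.aestronglyMeasurable C (ae_of_all _ hC)

section Ergodic

variable {d : ℕ} {X : Type*} [AddAction (E d) X] [TopologicalSpace X] [CompactSpace X]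
  [TopologicalSpace.MetrizableSpace X] [MeasurableSpace X] [BorelSpace X] [ContinuousVAdd (E d) X]

theorem integral_boxAverage {f : X → ℝ} (hf : Continuous f) (μ : Measure X)
    [IsProbabilityMeasure μ] [VAddInvariantMeasure (E d) X μ] (B : Box d) :
    ∫ T, boxAverage B f T ∂μ = ∫ T, f T ∂μ := by
  obtain ⟨C, hC⟩ := exists_abs_le_of_continuous hf
  have hc : Continuous (Function.uncurry fun (T : X) (t : E d) => f (-t +ᵥ T)) :=
    hf.comp (continuous_snd.neg.vadd continuous_fst)
  have := integral_integral_swap (μ := μ) (ν := B.unif)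
    (f := fun (T : X) (t : E d) => f (-t +ᵥ T))
    (Integrable.of_bound hc.aestronglyMeasurable C (ae_of_all _ fun _ => hC _))
  unfold boxAverage
  rw [this]
  have h : ∀ t : E d, ∫ T, f (-t +ᵥ T) ∂μ = ∫ T, f T ∂μ := fun t =>
    (measurePreserving_vadd (-t) μ).integral_comp
      (Homeomorph.vadd (-t)).measurableEmbedding f
  simp [h]

theorem uniquelyErgodic_of_linearlyRecurrent [Nonempty X] (hd : 1 ≤ d)
    (hLR : LinearlyRecurrent d X) :
    ∃ μ : Measure X, IsProbabilityMeasure μ ∧ VAddInvariantMeasure (E d) X μ ∧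
      (∀ ν : Measure X, IsProbabilityMeasure ν → VAddInvariantMeasure (E d) X ν → ν = μ) ∧
      ∀ f : X → ℝ, Continuous f → ∀ ε : ℝ, 0 < ε → ∃ R : ℝ, ∀ B : Box d, R ≤ B.width → ∀ T : X,
        |boxAverage B f T - ∫ S, f S ∂μ| ≤ ε := by
  have hlim : ∀ f : X → ℝ, Continuous f → ∃ l : ℝ, ∀ ε : ℝ, 0 < ε → ∃ R : ℝ, ∀ B : Box d,
      R ≤ B.width → ∀ T : X, |boxAverage B f T - l| ≤ ε := fun f hf => by
    obtain ⟨C, hC⟩ := exists_abs_le_of_continuous hf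
    exact exists_boxAverage_tendsto hd hLR hf hC
  choose! l hl using hlim
  obtain ⟨T₀⟩ := ‹Nonempty X›
  let Q : ℕ → Box d := fun n => Box.cube 0 (n.cast_add_one_pos : (0 : ℝ) < n + 1)
  have hQw : ∀ n, (Q n).width = n + 1 := fun n => Box.width_cube hd _ _
  have horb : Continuous fun t : E d => -t +ᵥ T₀ := continuous_neg.vadd continuous_const
  let p : ℕ → ProbabilityMeasure X := fun n =>
    ⟨(Q n).unif.map fun t : E d => -t +ᵥ T₀,
      Measure.isProbabilityMeasure_map horb.measurable.aemeasurable⟩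
  have hp : ∀ n (f : X → ℝ), Continuous f →
      ∫ S, f S ∂(p n : Measure X) = boxAverage (Q n) f T₀ := fun n f hf =>
    integral_map horb.measurable.aemeasurable hf.aestronglyMeasurable
  have hpl : ∀ f : X → ℝ, Continuous f →
      Tendsto (fun n => ∫ S, f S ∂(p n : Measure X)) atTop (𝓝 (l f)) := by
    intro f hf
    rw [Metric.tendsto_atTop]
    intro ε hε
    obtain ⟨R, hR⟩ := hl f hf (ε / 2) (by positivity)
    refine ⟨⌈R⌉₊, fun n hn => ?_⟩
    rw [hp n f hf, Real.dist_eq]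
    refine (hR (Q n) ?_ T₀).trans_lt (by linarith)
    rw [hQw]
    linarith [Nat.ceil_le.1 hn]
  -- Probability measures on a compact metrizable space form a compact space, so a limit along an
  -- ultrafilter exists. Its integrals are the limits `l f`, as the integrals converge along the
  -- whole sequence.
  obtain ⟨μ, hμ⟩ : ∃ μ : ProbabilityMeasure X, Tendsto p (hyperfilter ℕ) (𝓝 μ) :=
    ⟨_, ((hyperfilter ℕ).map p).le_nhds_lim⟩
  have hint : ∀ f : X → ℝ, Continuous f → ∫ S, f S ∂(μ : Measure X) = l f := by
    intro f hf
    have h1 := (ProbabilityMeasure.tendsto_iff_forall_integral_tendsto.1 hμ)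
      (BoundedContinuousFunction.mkOfCompact ⟨f, hf⟩)
    exact tendsto_nhds_unique h1 ((hpl f hf).mono_left Nat.hyperfilter_le_atTop)
  have hunique : ∀ ν : Measure X, IsProbabilityMeasure ν →
      (∀ f : X → ℝ, Continuous f → ∫ S, f S ∂ν = l f) → ν = μ := fun ν hν h =>
    ext_of_forall_integral_eq_of_IsFiniteMeasure fun f => by
      rw [h f f.continuous, hint f f.continuous]
  have hinv : VAddInvariantMeasure (E d) X (μ : Measure X) := by
    have hmap : ∀ v : E d, (μ : Measure X).map (v +ᵥ ·) = μ := by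
      intro v
      have hv : Continuous fun S : X => v +ᵥ S := continuous_const_vadd v
      refine hunique _ (Measure.isProbabilityMeasure_map hv.measurable.aemeasurable) fun f hf => ?_
      rw [integral_map hv.measurable.aemeasurable hf.aestronglyMeasurable,
        hint (fun S => f (v +ᵥ S)) (hf.comp hv)]
      refine eq_of_forall_dist_le fun ε hε => ?_
      obtain ⟨R, hR⟩ := hl (fun S => f (v +ᵥ S)) (hf.comp hv) (ε / 2) (by positivity)
      obtain ⟨R', hR'⟩ := hl f hf (ε / 2) (by positivity)
      let B : Box d := Box.cube 0 (lt_max_of_lt_right one_pos : 0 < max (max R R') 1)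
      have hB : B.width = max (max R R') 1 := Box.width_cube hd _ _
      have h1 := hR B (by rw [hB]; exact (le_max_left _ _).trans (le_max_left _ _)) T₀
      have h2 := hR' B (by rw [hB]; exact (le_max_right _ _).trans (le_max_left _ _)) (v +ᵥ T₀)
      -- Invariance comes from uniformity in the point: the same limit `l f` is found from `v +ᵥ T₀`
      -- as from `T₀`.
      have h3 : boxAverage B (fun S => f (v +ᵥ S)) T₀ = boxAverage B f (v +ᵥ T₀) := by
        simp only [boxAverage, vadd_vadd, add_comm]
      rw [h3] at h1
      rw [abs_le] at h1 h2
      rw [Real.dist_eq, abs_le]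
      constructor <;> linarith
    exact ⟨fun v s hs => by
      rw [← Measure.map_apply (continuous_const_vadd v).measurable hs, hmap v]⟩
  refine ⟨μ, inferInstance, hinv, fun ν hν hνinv => hunique ν hν fun f hf => ?_, fun f hf => ?_⟩
  · refine eq_of_forall_dist_le fun ε hε => ?_
    obtain ⟨R, hR⟩ := hl f hf ε hε
    let B : Box d := Box.cube 0 (lt_max_of_lt_right one_pos : 0 < max R 1)
    have hB : B.width = max R 1 := Box.width_cube hd _ _
    -- Integrating the uniform estimate against an invariant `ν` replaces the box average by `f`
    -- itself, so `ν` has the same integrals as `μ`.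
    have h1 := hR B (by rw [hB]; exact le_max_left _ _)
    obtain ⟨C, hC⟩ := exists_abs_le_of_continuous hf
    have h2 : Integrable (boxAverage B f) ν :=
      integrable_of_continuous (continuous_boxAverage hf hC B) ν
    have h3 := norm_integral_le_of_norm_le_const (μ := ν)
      (f := fun T => boxAverage B f T - l f) (ae_of_all _ h1)
    rw [integral_sub h2 (integrable_const _), integral_boxAverage hf] at h3
    simpa [Real.dist_eq] using h3
  · rw [hint f hf]
    exact hl f hf

end Ergodic

/-! ### Tiles of the tilings in the tiling space -/

section Tiles

variable {d : ℕ} {Γ : Type*}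

theorem IsTileShape.isCompact {a : Set (E d)} (h : IsTileShape a) : IsCompact a := by
  obtain ⟨e⟩ := h
  have : CompactSpace (closedBall (0 : E d) 1) :=
    isCompact_iff_compactSpace.1 (isCompact_closedBall 0 1)
  exact isCompact_iff_compactSpace.2 e.symm.compactSpace

theorem IsTileShape.nonempty {a : Set (E d)} (h : IsTileShape a) : a.Nonempty := by
  obtain ⟨e⟩ := h
  exact ⟨e.symm ⟨0, by simp⟩, Subtype.coe_prop _⟩

theorem IsTileFamily.mono {M N : Set (DTile d Γ)} (hN : IsTileFamily N) (h : M ⊆ N) :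
    IsTileFamily M :=
  ⟨fun m hm => hN.isTileShape m (h hm), hN.disjoint.mono h⟩

theorem mem_shiftTile_image {v : E d} {M : Set (DTile d Γ)} {m : DTile d Γ} :
    m ∈ shiftTile v '' M ↔ shiftTile (-v) m ∈ M := by
  constructor
  · rintro ⟨n, hn, rfl⟩
    rwa [← shiftTile_add, neg_add_cancel, shiftTile_zero]
  · intro h
    exact ⟨_, h, by rw [← shiftTile_add, add_neg_cancel, shiftTile_zero]⟩

theorem Tiling.mem_vadd {v : E d} {T : Tiling d Γ} {m : DTile d Γ} :
    m ∈ (v +ᵥ T).tiles ↔ shiftTile (-v) m ∈ T.tiles :=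
  mem_shiftTile_image

theorem Tiling.exists_mem (T : Tiling d Γ) (x : E d) : ∃ m ∈ T.tiles, x ∈ m.1 := by
  have : x ∈ support T.tiles := T.cover ▸ Set.mem_univ x
  simpa [support] using this

variable {Pset : Set (AbstractPattern d Γ)}

theorem TilingSpace.coe_vadd (v : E d) (T : TilingSpace Pset) : (v +ᵥ T).1 = v +ᵥ T.1 := rfl

theorem TilingSpace.toAbstract_mem (T : TilingSpace Pset) {P : Pattern d Γ}
    (h : P.tiles ⊆ T.1.tiles) : P.toAbstract ∈ Pset :=
  T.2 ⟨P, rfl, h⟩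

variable (Pset) in
/-- Uniform bounds for the tiles of the tilings associated to `Pset`: each of them contains a ball
of radius `r` and has diameter at most `D`. -/
structure TileBounds (r D : ℝ) : Prop where
  r_pos : 0 < r
  D_pos : 0 < D
  exists_closedBall_subset : ∀ (T : TilingSpace Pset), ∀ m ∈ T.1.tiles,
    ∃ x, closedBall x r ⊆ m.1
  dist_le : ∀ (T : TilingSpace Pset), ∀ m ∈ T.1.tiles, ∀ x ∈ m.1, ∀ y ∈ m.1, dist x y ≤ D

theorem dist_le_of_outerRadius_le {a : Set (E d)} (ha : Bornology.IsBounded a) {R : ℝ}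
    (h : outerRadius a ≤ R) {x y : E d} (hx : x ∈ a) (hy : y ∈ a) : dist x y ≤ 2 * R := by
  refine le_of_forall_pos_le_add fun ε hε => ?_
  have hne : {r : ℝ | ∃ x : E d, a ⊆ closedBall x r}.Nonempty := by
    obtain ⟨r, hr⟩ := ha.subset_closedBall (0 : E d)
    exact ⟨r, 0, hr⟩
  obtain ⟨r, ⟨z, hz⟩, hr⟩ := exists_lt_of_csInf_lt hne
    (show outerRadius a < R + ε / 2 by linarith)
  have h1 := mem_closedBall.1 (hz hx)
  have h2 := mem_closedBall'.1 (hz hy)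
  linarith [dist_triangle x z y]

theorem exists_closedBall_subset_of_lt_innerRadius {a : Set (E d)} {r : ℝ}
    (h : r < innerRadius a) : ∃ x, closedBall x r ⊆ a := by
  -- A ball of negative radius is empty, so the set of radii is never empty.
  have hne : {r : ℝ | ∃ x : E d, closedBall x r ⊆ a}.Nonempty := ⟨-1, 0, by simp⟩
  obtain ⟨s, ⟨x, hx⟩, hs⟩ := exists_lt_of_lt_csSup hne h
  exact ⟨x, (closedBall_subset_closedBall hs.le).trans hx⟩

theorem Admissible.exists_tileBounds (h : Admissible Pset) : ∃ r D, TileBounds Pset r D := by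
  obtain ⟨r, D, hr, hD, hb⟩ := h.radii
  have key : ∀ (T : TilingSpace Pset), ∀ m ∈ T.1.tiles, IsTileShape m.1 ∧
      r ≤ innerRadius m.1 ∧ outerRadius m.1 ≤ D := by
    intro T m hm
    have hsub : {m} ⊆ T.1.tiles := Set.singleton_subset_iff.2 hm
    have := hb ⟨{m}, Set.finite_singleton m, T.1.isTileFamily.mono hsub⟩
      (T.toAbstract_mem hsub) m rfl
    exact ⟨T.1.isTileFamily.isTileShape m hm, this.1, this.2.2⟩
  -- Halving `r` gives a strict inequality, so it does not matter whether the supremum in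
  -- `innerRadius` is attained; a diameter is at most twice the outer radius.
  refine ⟨r / 2, 2 * D, by positivity, by positivity, fun T m hm => ?_, fun T m hm x hx y hy => ?_⟩
  · exact exists_closedBall_subset_of_lt_innerRadius (by linarith [(key T m hm).2.1])
  · exact dist_le_of_outerRadius_le (key T m hm).1.isCompact.isBounded (key T m hm).2.2 hx hy

namespace TileBounds

variable {r D : ℝ} (hb : TileBounds Pset r D)
include hb

theorem subset_closedBall (T : TilingSpace Pset) {m : DTile d Γ} (hm : m ∈ T.1.tiles) {R : ℝ}
    (h : (m.1 ∩ closedBall 0 R).Nonempty) : m.1 ⊆ closedBall 0 (R + D) := by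
  obtain ⟨x, hx, hxR⟩ := h
  intro y hy
  rw [mem_closedBall] at hxR ⊢
  linarith [dist_triangle y x 0, hb.dist_le T m hm y hy x hx]

/-- A packing argument: the interiors are disjoint, each has at least the volume of a ball of radius
`r`, and all lie in a ball of radius `R + D`. -/
theorem finite_tiles (T : TilingSpace Pset) (R : ℝ) :
    {m ∈ T.1.tiles | (m.1 ∩ closedBall 0 R).Nonempty}.Finite := by
  let A : {m ∈ T.1.tiles | (m.1 ∩ closedBall 0 R).Nonempty} → Set (E d) :=
    fun m => interior m.1.1
  have hfin := Measure.finite_const_le_meas_of_disjoint_iUnion (volume : Measure (E d))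
    (measure_ball_pos volume (0 : E d) hb.r_pos) (As := A)
    (fun m => isOpen_interior.measurableSet)
    (fun m n hmn => T.1.isTileFamily.disjoint m.2.1 n.2.1 fun h => hmn (Subtype.ext h))
    (measure_ne_top_of_subset (Set.iUnion_subset fun m => interior_subset.trans
      (hb.subset_closedBall T m.2.1 m.2.2)) measure_closedBall_lt_top.ne)
  have huniv : {m | volume (ball (0 : E d) r) ≤ volume (A m)} = Set.univ := by
    refine Set.eq_univ_of_forall fun m => ?_
    obtain ⟨x, hx⟩ := hb.exists_closedBall_subset T m.1 m.2.1
    rw [Set.mem_ofPred_eq, ← Measure.addHaar_ball_center volume x r]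
    exact measure_mono (interior_maximal (ball_subset_closedBall.trans hx) isOpen_ball)
  rw [huniv, Set.finite_univ_iff] at hfin
  exact Set.toFinite _

/-- The pattern of all tiles of a tiling that meet a ball about the origin. -/
def patch (T : TilingSpace Pset) (R : ℝ) : Pattern d Γ where
  tiles := {m ∈ T.1.tiles | (m.1 ∩ closedBall 0 R).Nonempty}
  finite := hb.finite_tiles T R
  isTileFamily := T.1.isTileFamily.mono (Set.sep_subset _ _)

omit hb in
theorem closedBall_subset_support (T : Tiling d Γ) (R : ℝ) :
    closedBall 0 R ⊆ support {m ∈ T.tiles | (m.1 ∩ closedBall 0 R).Nonempty} := by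
  intro x hx
  obtain ⟨m, hm, hxm⟩ := T.exists_mem x
  exact Set.mem_biUnion (x := m) ⟨hm, x, hxm, hx⟩ hxm

end TileBounds

/-! ### Tilings that agree on a ball -/

/-- Two tilings have the same tiles among those that meet the ball of radius `R` about `0`. -/
def Agree (R : ℝ) (T S : Tiling d Γ) : Prop :=
  ∀ m : DTile d Γ, (m.1 ∩ closedBall 0 R).Nonempty → (m ∈ T.tiles ↔ m ∈ S.tiles)

namespace Agree

variable {R R' : ℝ} {T S W : Tiling d Γ}

theorem refl (R : ℝ) (T : Tiling d Γ) : Agree R T T := fun _ _ => Iff.rfl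

theorem symm (h : Agree R T S) : Agree R S T := fun m hm => (h m hm).symm

theorem trans (h : Agree R T S) (h' : Agree R S W) : Agree R T W :=
  fun m hm => (h m hm).trans (h' m hm)

theorem mono (h : Agree R T S) (hR : R' ≤ R) : Agree R' T S := fun m hm =>
  h m (hm.mono (Set.inter_subset_inter_right _ (closedBall_subset_closedBall hR)))

theorem vadd (h : Agree R T S) {v : E d} (hv : R' + ‖v‖ ≤ R) : Agree R' (v +ᵥ T) (v +ᵥ S) := by
  rintro m ⟨x, hx, hxR⟩
  rw [Tiling.mem_vadd, Tiling.mem_vadd]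
  refine h _ ⟨-v +ᵥ x, Set.vadd_mem_vadd_set hx, ?_⟩
  rw [mem_closedBall_zero_iff] at hxR ⊢
  calc ‖-v + x‖ ≤ ‖-v‖ + ‖x‖ := norm_add_le _ _
    _ ≤ R := by rw [norm_neg]; linarith

theorem restrict_eq (h : Agree R T S) :
    T.restrict (closedBall 0 R) = S.restrict (closedBall 0 R) := by
  have key : ∀ m : DTile d Γ, (m.1 ∩ interior (closedBall 0 R)).Nonempty →
      (m ∈ T.tiles ↔ m ∈ S.tiles) := fun m hm =>
    h m (hm.mono (Set.inter_subset_inter_right _ interior_subset))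
  ext p
  constructor
  · rintro ⟨m, hm, hne, rfl⟩
    exact ⟨m, (key m hne).1 hm, hne, rfl⟩
  · rintro ⟨m, hm, hne, rfl⟩
    exact ⟨m, (key m hne).2 hm, hne, rfl⟩

end Agree

theorem eq_of_nonempty_interior_inter {T : Tiling d Γ} {m n : DTile d Γ} (hm : m ∈ T.tiles)
    (hn : n ∈ T.tiles) (h : (interior m.1 ∩ interior n.1).Nonempty) : m = n := by
  by_contra hne
  exact Set.not_disjoint_iff_nonempty_inter.2 h (T.isTileFamily.disjoint hm hn hne)

/-- A finite form of Baire's theorem, valid in any topological space: either `U` lies in one of the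
closed sets, or removing that set leaves a nonempty open set covered by the others. -/
theorem exists_nonempty_interior_inter {X ι : Type*} [TopologicalSpace X] {s : Set ι}
    (hs : s.Finite) {F : ι → Set X} (hF : ∀ i ∈ s, IsClosed (F i)) {U : Set X} (hU : IsOpen U)
    (hne : U.Nonempty) (h : U ⊆ ⋃ i ∈ s, F i) : ∃ i ∈ s, (U ∩ interior (F i)).Nonempty := by
  induction s, hs using Set.Finite.induction_on generalizing U with
  | empty =>
    obtain ⟨x, hx⟩ := hne
    simpa using h hx
  | @insert a s ha hs ih =>
    by_cases hUa : U ⊆ F a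
    · exact ⟨a, Set.mem_insert _ _, by
        rwa [Set.inter_eq_left.2 (interior_maximal hUa hU)]⟩
    · obtain ⟨i, hi, hi'⟩ := ih (fun i hi => hF i (Set.mem_insert_of_mem _ hi)) (U := U \ F a)
        (hU.sdiff (hF a (Set.mem_insert _ _))) (Set.sdiff_nonempty.2 hUa) (by
          rintro x ⟨hxU, hxa⟩
          have := h hxU
          rw [Set.biUnion_insert] at this
          exact this.resolve_left hxa)
      exact ⟨i, Set.mem_insert_of_mem _ hi,
        hi'.mono (Set.inter_subset_inter_left _ Set.sdiff_subset)⟩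

namespace TileBounds

variable {r D : ℝ} (hb : TileBounds Pset r D)
include hb

/-- One inclusion suffices because `T` covers space: a tile of `S` near the origin overlaps the
interior of some tile of `T`, which by hypothesis belongs to `S` too, so the two coincide. -/
theorem agree_of_subset {T S : TilingSpace Pset} {R : ℝ}
    (h : ∀ m ∈ T.1.tiles, (m.1 ∩ closedBall 0 (R + D)).Nonempty → m ∈ S.1.tiles) :
    Agree R T.1 S.1 := by
  refine fun m hm => ⟨fun hmT => h m hmT (hm.mono (Set.inter_subset_inter_right _
    (closedBall_subset_closedBall (by linarith [hb.D_pos])))), fun hmS => ?_⟩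
  obtain ⟨x, hx⟩ := hb.exists_closedBall_subset S m hmS
  have hne : (interior m.1).Nonempty :=
    ⟨x, interior_maximal (ball_subset_closedBall.trans hx) isOpen_ball (mem_ball_self hb.r_pos)⟩
  obtain ⟨n, ⟨hnT, hnR⟩, hn⟩ := exists_nonempty_interior_inter (hb.finite_tiles T (R + D))
    (F := fun n => n.1) (fun n hn => (T.1.isTileFamily.isTileShape n hn.1).isCompact.isClosed)
    isOpen_interior hne (interior_subset.trans ((hb.subset_closedBall S hmS hm).trans
      (closedBall_subset_support T.1 _)))
  rwa [eq_of_nonempty_interior_inter hmS (h n hnT hnR) hn]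

theorem eq_of_subset {T S : TilingSpace Pset} (h : T.1.tiles ⊆ S.1.tiles) : T = S := by
  refine Subtype.ext (Tiling.ext (h.antisymm fun m hm => ?_))
  obtain ⟨x, hx⟩ := (S.1.isTileFamily.isTileShape m hm).nonempty
  exact (hb.agree_of_subset (R := ‖x‖) fun m hm _ => h hm) m ⟨x, hx, by simp⟩ |>.2 hm

/-- Tiles that meet the smaller ball lie inside the larger one, so the restriction does not cut
them. -/
theorem agree_of_restrict_eq {T S : TilingSpace Pset} {R R' : ℝ} (hR : R + D < R')
    (h : T.1.restrict (closedBall 0 R') = S.1.restrict (closedBall 0 R')) :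
    Agree R T.1 S.1 := by
  have key : ∀ T S : TilingSpace Pset,
      T.1.restrict (closedBall 0 R') = S.1.restrict (closedBall 0 R') →
      ∀ m : DTile d Γ, (m.1 ∩ closedBall 0 R).Nonempty → m ∈ T.1.tiles → m ∈ S.1.tiles := by
    intro T S h m hm hmT
    have hint : ∀ (T : TilingSpace Pset) (m : DTile d Γ), m ∈ T.1.tiles →
        (m.1 ∩ closedBall 0 R).Nonempty → m.1 ⊆ interior (closedBall 0 R') := fun T m hmT hm =>
      ((hb.subset_closedBall T hmT hm).trans (closedBall_subset_ball hR)).trans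
        ball_subset_interior_closedBall
    have hsub := hint T m hmT hm
    have hmem : m ∈ T.1.restrict (closedBall 0 R') := by
      refine ⟨m, hmT, ?_, ?_⟩
      · obtain ⟨x, hx, -⟩ := hm
        exact ⟨x, hx, hsub hx⟩
      · rw [Set.inter_eq_left.2 (hsub.trans interior_subset)]
    rw [h] at hmem
    obtain ⟨n, hnS, -, hn⟩ := hmem
    have hn1 : m.1 = n.1 ∩ closedBall 0 R' := congrArg Prod.fst hn
    have hnR : (n.1 ∩ closedBall 0 R).Nonempty :=
      hm.mono (Set.inter_subset_inter_left _ (hn1.le.trans Set.inter_subset_left))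
    rw [Set.inter_eq_left.2 ((hint S n hnS hnR).trans interior_subset)] at hn
    rwa [hn]
  exact fun m hm => ⟨key T S h m hm, key S T h.symm m hm⟩

end TileBounds

end Tiles

open scoped Uniformity

/-! ### The uniform structure of the tiling space -/

section Uniform

variable {d : ℕ} {Γ : Type*}

/-- Up to a translation by at most `1 / R`, two tilings agree on the ball of radius `R`. -/
def Near (R : ℝ) (T S : Tiling d Γ) : Prop := ∃ t : E d, ‖t‖ ≤ 1 / R ∧ Agree R T (t +ᵥ S)

namespace Near

variable {R R' : ℝ} {T S W : Tiling d Γ}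

theorem mono (h : Near R T S) (hR' : 0 < R') (hR : R' ≤ R) : Near R' T S := by
  obtain ⟨t, ht, hA⟩ := h
  exact ⟨t, ht.trans (one_div_le_one_div_of_le hR' hR), hA.mono hR⟩

theorem refl (hR : 0 ≤ R) (T : Tiling d Γ) : Near R T T :=
  ⟨0, by simpa using hR, by rw [zero_vadd]; exact Agree.refl R T⟩

theorem symm (hR : 1 ≤ R) (h : Near (R + 1) T S) : Near R S T := by
  obtain ⟨t, ht, hA⟩ := h
  have ht' : ‖t‖ ≤ 1 / R := ht.trans (one_div_le_one_div_of_le (by linarith) (by linarith))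
  have ht1 : ‖t‖ ≤ 1 := ht'.trans ((div_le_one (by linarith)).2 hR)
  refine ⟨-t, by rwa [norm_neg], ?_⟩
  have := hA.symm.vadd (R' := R) (v := -t) (by rw [norm_neg]; linarith)
  rwa [neg_vadd_vadd] at this

theorem trans (hR : 1 ≤ R) (h : Near (2 * R) T S) (h' : Near (2 * R) S W) : Near R T W := by
  obtain ⟨t, ht, hA⟩ := h
  obtain ⟨u, hu, hA'⟩ := h'
  have hR2 : 1 / (2 * R) + 1 / (2 * R) = 1 / R := by field_simp; norm_num
  have h1 : 1 / (2 * R) ≤ 1 := (div_le_one (by linarith)).2 (by linarith)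
  refine ⟨t + u, (norm_add_le _ _).trans (by linarith), ?_⟩
  rw [add_vadd]
  exact (hA.mono (by linarith)).trans (hA'.vadd (by linarith))

end Near

theorem directed_near {α : Type*} (i : α → Tiling d Γ) :
    Directed (· ≥ ·) fun n : ℕ => {p : α × α | Near (n + 1) (i p.1) (i p.2)} :=
  Antitone.directed_ge fun _ _ hmn _ hp =>
    Near.mono hp (by positivity) (by exact_mod_cast Nat.add_le_add_right hmn 1)

variable {Pset : Set (AbstractPattern d Γ)}

variable (Pset) in
/-- The uniformity on the tiling space given by the relations `Near`. -/
def nearCore : UniformSpace.Core (TilingSpace Pset) where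
  uniformity := ⨅ n : ℕ, 𝓟 {p | Near (n + 1) p.1.1 p.2.1}
  refl := by
    refine le_iInf fun n => principal_mono.2 ?_
    rintro ⟨T, S⟩ (rfl : T = S)
    exact Near.refl (by positivity) _
  symm := by
    refine (hasBasis_iInf_principal (directed_near Subtype.val)).tendsto_iff
      (hasBasis_iInf_principal (directed_near Subtype.val)) |>.2 fun n _ => ⟨n + 1, trivial, ?_⟩
    rintro ⟨T, S⟩ h
    have h' : Near (((n + 1 : ℕ) : ℝ) + 1) T.1 S.1 := h
    push_cast at h'
    exact h'.symm (by linarith [n.cast_nonneg (α := ℝ)])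
  comp := by
    refine ((hasBasis_iInf_principal (directed_near Subtype.val)).lift'
      (monotone_id.relComp monotone_id)).le_basis_iff
      (hasBasis_iInf_principal (directed_near Subtype.val)) |>.2
      fun n _ => ⟨2 * n + 1, trivial, ?_⟩
    rintro ⟨T, W⟩ ⟨S, h1, h2⟩
    have h1' : Near (((2 * n + 1 : ℕ) : ℝ) + 1) T.1 S.1 := h1
    have h2' : Near (((2 * n + 1 : ℕ) : ℝ) + 1) S.1 W.1 := h2
    have e : ((2 * n + 1 : ℕ) : ℝ) + 1 = 2 * (n + 1) := by push_cast; ring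
    rw [e] at h1' h2'
    exact h1'.trans (by linarith [n.cast_nonneg (α := ℝ)]) h2'

theorem isOpen_nearCore_iff {U : Set (TilingSpace Pset)} :
    IsOpen[(UniformSpace.ofCore (nearCore Pset)).toTopologicalSpace] U ↔
      ∀ T ∈ U, ∃ n : ℕ, ∀ S : TilingSpace Pset, Near (n + 1) T.1 S.1 → S ∈ U := by
  let u := UniformSpace.ofCore (nearCore Pset)
  have hbasis : (𝓤 (TilingSpace Pset)).HasBasis (fun _ : ℕ => True)
      fun n => {p | Near (n + 1) p.1.1 p.2.1} :=
    hasBasis_iInf_principal (directed_near Subtype.val)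
  refine _root_.isOpen_iff_ball_subset.trans (forall₂_congr fun T _ => ?_)
  constructor
  · rintro ⟨V, hV, hVU⟩
    obtain ⟨n, -, hn⟩ := hbasis.mem_iff.1 hV
    exact ⟨n, fun S hS => hVU (hn hS)⟩
  · rintro ⟨n, hn⟩
    exact ⟨_, hbasis.mem_of_mem (i := n) trivial, fun S hS => hn S hS⟩

theorem tilingDist_le_of_near {T S : Tiling d Γ} {R : ℝ} (hR : 0 < R) (h : Near R T S) :
    tilingDist T S ≤ ENNReal.ofReal (1 / R) := by
  obtain ⟨t, ht, hA⟩ := h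
  refine iInf₂_le (1 / R) ⟨by positivity, t, ht, ?_⟩
  rw [one_div_one_div]
  exact hA.restrict_eq

namespace TileBounds

variable {r D : ℝ} (hb : TileBounds Pset r D)
include hb

theorem near_of_tilingDist_lt {T S : TilingSpace Pset} {R : ℝ} (hR : 0 < R)
    (h : tilingDist T.1 S.1 < ENNReal.ofReal (1 / (R + D))) : Near R T.1 S.1 := by
  have hD := hb.D_pos
  simp only [tilingDist, iInf_lt_iff] at h
  obtain ⟨ε, ⟨hε, t, ht, hres⟩, hlt⟩ := h
  have hεR := (ENNReal.ofReal_lt_ofReal_iff (by positivity)).1 hlt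
  refine ⟨t, ht.trans (hεR.le.trans (one_div_le_one_div_of_le hR (by linarith))), ?_⟩
  exact hb.agree_of_restrict_eq (S := t +ᵥ S) ((lt_one_div (by positivity) hε).2 hεR) hres

theorem isOpen_iff {U : Set (TilingSpace Pset)} :
    IsOpen U ↔ ∀ T ∈ U, ∃ n : ℕ, ∀ S : TilingSpace Pset, Near (n + 1) T.1 S.1 → S ∈ U := by
  refine forall₂_congr fun T _ => ?_
  constructor
  · rintro ⟨ε, hε, h⟩
    obtain ⟨δ, hδ, hδε⟩ : ∃ δ : ℝ, 0 < δ ∧ ENNReal.ofReal δ < ε := by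
      obtain ⟨δ, hδ, hδε⟩ := ENNReal.lt_iff_exists_nnreal_btwn.1 hε
      exact ⟨δ, by exact_mod_cast hδ, by rwa [ENNReal.ofReal_coe_nnreal]⟩
    obtain ⟨n, hn⟩ := exists_nat_one_div_lt hδ
    exact ⟨n, fun S hS => h S ((tilingDist_le_of_near (by positivity) hS).trans_lt
      ((ENNReal.ofReal_le_ofReal hn.le).trans_lt hδε))⟩
  · rintro ⟨n, h⟩
    have hD := hb.D_pos
    exact ⟨ENNReal.ofReal (1 / ((n + 1 : ℝ) + D)), ENNReal.ofReal_pos.2 (by positivity),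
      fun S hS => h S (hb.near_of_tilingDist_lt (by positivity) hS)⟩

/-- The uniform structure inducing the topology of the tiling space. -/
abbrev uniformSpace : UniformSpace (TilingSpace Pset) :=
  (UniformSpace.ofCore (nearCore Pset)).replaceTopology (TopologicalSpace.ext_iff.2 fun _ =>
    hb.isOpen_iff.trans isOpen_nearCore_iff.symm)

theorem hasBasis_uniformity :
    (𝓤[hb.uniformSpace]).HasBasis (fun _ : ℕ => True) fun n => {p | Near (n + 1) p.1.1 p.2.1} :=
  hasBasis_iInf_principal (directed_near Subtype.val)

theorem hasBasis_nhds (T : TilingSpace Pset) :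
    (𝓝 T).HasBasis (fun _ : ℕ => True) fun n => {S | Near (n + 1) T.1 S.1} := by
  let := hb.uniformSpace
  exact nhds_basis_uniformity' hb.hasBasis_uniformity

theorem isCountablyGenerated_uniformity : (𝓤[hb.uniformSpace]).IsCountablyGenerated :=
  hb.hasBasis_uniformity.isCountablyGenerated

/-- Distinct translates of a tile are distinct. -/
theorem eq_of_shiftTile_eq (T : TilingSpace Pset) {m : DTile d Γ} (hm : m ∈ T.1.tiles)
    {s t : E d} (h : shiftTile s m = shiftTile t m) : s = t := by
  have hshape := T.1.isTileFamily.isTileShape m hm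
  obtain ⟨x, hx⟩ := hshape.nonempty
  -- A bounded nonempty set has no nonzero period: the multiples of `s - t` would carry a point of
  -- it arbitrarily far.
  have hset : (s - t) +ᵥ m.1 = m.1 := by
    have h1 : s +ᵥ m.1 = t +ᵥ m.1 := congrArg Prod.fst h
    rw [sub_eq_neg_add, add_vadd, h1, neg_vadd_vadd]
  have hiter : ∀ n : ℕ, n • (s - t) + x ∈ m.1 := by
    intro n
    induction n with
    | zero => simpa using hx
    | succ n ih =>
      rw [succ_nsmul', add_assoc, ← hset]
      exact Set.vadd_mem_vadd_set ih
  by_contra hne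
  have hpos : 0 < ‖s - t‖ := norm_pos_iff.2 (sub_ne_zero.2 hne)
  obtain ⟨n, hn⟩ := exists_nat_gt (D / ‖s - t‖)
  rw [div_lt_iff₀ hpos] at hn
  have := hb.dist_le T m hm _ (hiter n) x hx
  rw [dist_eq_norm, add_sub_cancel_right, ← Nat.cast_smul_eq_nsmul ℝ, norm_smul,
    Real.norm_natCast] at this
  linarith

/-- For a tile `m` of `T`, the short vectors `t` for which `m` translated by `-t` is in `S` form a
finite, hence closed, set. Nearness at all scales puts `0` in its closure, so `m` is itself a tile
of `S`. -/
theorem eq_of_forall_near {T S : TilingSpace Pset} (h : ∀ n : ℕ, Near (n + 1) T.1 S.1) :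
    T = S := by
  refine hb.eq_of_subset fun m hm => ?_
  obtain ⟨x, hx⟩ := (T.1.isTileFamily.isTileShape m hm).nonempty
  let A : Set (E d) := {t | shiftTile (-t) m ∈ S.1.tiles ∧ ‖t‖ ≤ 1}
  have hfin : A.Finite := by
    refine Set.Finite.of_finite_image ((hb.finite_tiles S (‖x‖ + 1)).subset
      (t := (fun t => shiftTile (-t) m) '' A) ?_) ?_
    · rintro _ ⟨t, ⟨ht, ht1⟩, rfl⟩
      refine ⟨ht, -t +ᵥ x, Set.vadd_mem_vadd_set hx, ?_⟩
      rw [mem_closedBall_zero_iff]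
      refine (norm_add_le _ _).trans ?_
      rw [norm_neg]
      linarith
    · intro s _ t _ hst
      exact neg_injective (hb.eq_of_shiftTile_eq T hm hst)
  have hcl : (0 : E d) ∈ closure A := by
    rw [Metric.mem_closure_iff]
    intro ε hε
    obtain ⟨n, hn⟩ := exists_nat_one_div_lt hε
    obtain ⟨k, hk⟩ := exists_nat_ge ‖x‖
    have hN := h (max n k)
    obtain ⟨t, ht, hA⟩ := hN
    have hN1 : (n : ℝ) ≤ (max n k : ℕ) := by exact_mod_cast le_max_left n k
    have hN2 : (k : ℝ) ≤ (max n k : ℕ) := by exact_mod_cast le_max_right n k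
    refine ⟨t, ⟨?_, ht.trans ((div_le_one (by positivity)).2
      (by linarith [n.cast_nonneg (α := ℝ)]))⟩, ?_⟩
    · rw [← Tiling.mem_vadd]
      exact (hA m ⟨x, hx, by rw [mem_closedBall_zero_iff]; linarith⟩).1 hm
    · rw [dist_zero_left]
      refine (ht.trans (one_div_le_one_div_of_le (by positivity) ?_)).trans_lt hn
      linarith
  rw [hfin.isClosed.closure_eq] at hcl
  simpa [shiftTile_zero] using hcl.1

theorem metrizableSpace : TopologicalSpace.MetrizableSpace (TilingSpace Pset) := by
  let := hb.uniformSpace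
  have := hb.isCountablyGenerated_uniformity
  have : T0Space (TilingSpace Pset) := t0Space_iff_uniformity.2 fun T S h =>
    hb.eq_of_forall_near fun n => h _ (hb.hasBasis_uniformity.mem_of_mem (i := n) trivial)
  exact UniformSpace.metrizableSpace

theorem continuousVAdd : ContinuousVAdd (E d) (TilingSpace Pset) := by
  refine ⟨continuous_iff_continuousAt.2 fun ⟨v, T⟩ => ?_⟩
  refine ((hb.hasBasis_nhds (v +ᵥ T)).tendsto_right_iff).2 fun n _ => ?_
  have hε : (0 : ℝ) < 1 / (2 * (n + 1)) := by positivity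
  obtain ⟨k, hk⟩ := exists_nat_ge (max (n + 1 + ‖v‖) (2 * (n + 1)))
  have hk1 := (le_max_left _ _).trans hk
  have hk2 := (le_max_right _ _).trans hk
  refine Filter.mem_of_superset (prod_mem_nhds (ball_mem_nhds v hε)
    ((hb.hasBasis_nhds T).mem_of_mem (i := k) trivial)) ?_
  rintro ⟨w, S⟩ ⟨hw, t, ht, hA⟩
  refine ⟨v - w + t, ?_, ?_⟩
  · have h1 : ‖v - w‖ ≤ 1 / (2 * (n + 1)) := by
      rw [mem_ball'] at hw
      rw [← dist_eq_norm]
      exact hw.le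
    have h2 : ‖t‖ ≤ 1 / (2 * (n + 1)) :=
      ht.trans (one_div_le_one_div_of_le (by positivity) (by linarith))
    have h3 : 1 / (2 * ((n : ℝ) + 1)) + 1 / (2 * (n + 1)) = 1 / (n + 1) := by
      field_simp
      norm_num
    exact (norm_add_le _ _).trans (by linarith)
  · have := hA.vadd (R' := n + 1) (v := v) (by linarith)
    simp only [TilingSpace.coe_vadd]
    rw [vadd_vadd] at this ⊢
    convert this using 2
    abel

end TileBounds

end Uniform

/-! ### Limits of tile families -/

section Limit

variable {d : ℕ} {Γ : Type*} {Pset : Set (AbstractPattern d Γ)}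

/-- The tiles that eventually belong to a sequence of tile families form a tiling, provided that
they cover the space. -/
theorem exists_tilingSpace_mem_iff_eventually {M : ℕ → Set (DTile d Γ)}
    (hM : ∀ n, IsTileFamily (M n))
    (hP : ∀ n, ∀ P : Pattern d Γ, P.tiles ⊆ M n → P.toAbstract ∈ Pset)
    (hcover : ∀ x : E d, ∃ m : DTile d Γ, x ∈ m.1 ∧ ∀ᶠ n in atTop, m ∈ M n) :
    ∃ T : TilingSpace Pset, ∀ m, m ∈ T.1.tiles ↔ ∀ᶠ n in atTop, m ∈ M n := by
  refine ⟨⟨⟨{m | ∀ᶠ n in atTop, m ∈ M n}, ⟨fun m hm => ?_, fun m hm n hn hmn => ?_⟩, ?_⟩, ?_⟩,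
    fun m => Iff.rfl⟩
  · obtain ⟨n, hn⟩ := Eventually.exists hm
    exact (hM n).isTileShape m hn
  · obtain ⟨k, hk1, hk2⟩ := (Eventually.and hm hn).exists
    exact (hM k).disjoint hk1 hk2 hmn
  · refine Set.eq_univ_of_forall fun x => ?_
    obtain ⟨m, hx, hm⟩ := hcover x
    exact Set.mem_biUnion (x := m) hm hx
  · rintro _ ⟨P, rfl, hPM⟩
    obtain ⟨n, hn⟩ := ((eventually_all_finite P.finite).2 hPM).exists
    exact hP n P hn

/-- A pattern moved over the origin is extended again and again to cover growing balls; the union of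
the increasing chain is a tiling. -/
theorem Admissible.nonempty_tilingSpace (h : Admissible Pset)
    (hne : ∃ P : Pattern d Γ, P.toAbstract ∈ Pset ∧ P.tiles.Nonempty) :
    Nonempty (TilingSpace Pset) := by
  obtain ⟨P, hP, m, hm⟩ := hne
  obtain ⟨x, hx⟩ := (P.isTileFamily.isTileShape m hm).nonempty
  let P₀ : {P : Pattern d Γ // P.toAbstract ∈ Pset ∧ (0 : E d) ∈ support P.tiles} :=
    ⟨-x +ᵥ P, by rwa [Pattern.toAbstract_vadd], by
      rw [Pattern.tiles_vadd, support_shift]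
      exact ⟨x, Set.mem_biUnion hm hx, neg_add_cancel x⟩⟩
  have hstep : ∀ (n : ℕ) (P : {P : Pattern d Γ // P.toAbstract ∈ Pset ∧
      (0 : E d) ∈ support P.tiles}), ∃ Q : {P : Pattern d Γ // P.toAbstract ∈ Pset ∧
      (0 : E d) ∈ support P.tiles},
      closedBall (0 : E d) (n + 1) ⊆ support Q.1.tiles ∧ P.1.tiles ⊆ Q.1.tiles := by
    intro n P
    obtain ⟨Q, hQ, hQr, hPQ⟩ := h.extend P.1 P.2.1 P.2.2 (n + 1) (by positivity)
    exact ⟨⟨Q, hQ, hQr (mem_closedBall_self (by positivity))⟩, hQr, hPQ⟩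
  choose next hnext hsub using hstep
  let p : ℕ → {P : Pattern d Γ // P.toAbstract ∈ Pset ∧ (0 : E d) ∈ support P.tiles} :=
    fun n => Nat.rec P₀ next n
  have hmono : Monotone fun n => (p n).1.tiles := monotone_nat_of_le_succ fun n => hsub n (p n)
  obtain ⟨T, -⟩ := exists_tilingSpace_mem_iff_eventually (Pset := Pset)
    (M := fun n => (p n).1.tiles) (fun n => (p n).1.isTileFamily)
    (fun n P hP => h.subpattern _ (p n).2.1 _ ⟨P, (p n).1, rfl, rfl, hP⟩) fun x => by
      obtain ⟨n, hn⟩ := exists_nat_ge ‖x‖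
      have hx : x ∈ support (p (n + 1)).1.tiles := hnext n (p n) (by
        rw [mem_closedBall_zero_iff]; linarith)
      obtain ⟨m, hm, hxm⟩ := Set.mem_iUnion₂.1 hx
      exact ⟨m, hxm, eventually_atTop.2 ⟨n + 1, fun k hk => hmono hk hm⟩⟩
  exact ⟨T⟩

namespace TileBounds

variable {r D : ℝ} (hb : TileBounds Pset r D)
include hb

theorem completeSpace : @CompleteSpace (TilingSpace Pset) hb.uniformSpace := by
  let := hb.uniformSpace
  have := hb.isCountablyGenerated_uniformity
  refine UniformSpace.complete_of_convergent_controlled_sequences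
    (fun N => {p | Near (2 ^ N) p.1.1 p.2.1}) (fun N => ?_) fun u hu => ?_
  · refine mem_of_superset (hb.hasBasis_uniformity.mem_of_mem (i := 2 ^ N) trivial) fun p hp => ?_
    exact Near.mono hp (by positivity) (by push_cast; linarith)
  have hstep : ∀ n, Near (2 ^ n) (u n).1 (u (n + 1)).1 := fun n => hu n n (n + 1) le_rfl n.le_succ
  choose t ht hA using hstep
  have ht' : ∀ n, ‖t n‖ ≤ (1 / 2) ^ n := fun n => by
    rw [one_div_pow]
    exact ht n
  let s : ℕ → E d := fun n => ∑ k ∈ Finset.range n, t k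
  have hs : ∀ n, ‖s n‖ ≤ 2 := fun n =>
    (norm_sum_le _ _).trans ((Finset.sum_le_sum fun k _ => ht' k).trans (sum_geometric_two_le n))
  obtain ⟨a, ha⟩ : ∃ a, Tendsto s atTop (𝓝 a) :=
    ⟨_, (Summable.of_norm_bounded summable_geometric_two ht').hasSum.tendsto_sum_nat⟩
  -- The correcting translations are summable. Once they are accumulated, consecutive tilings agree
  -- exactly on balls of radius `2 ^ n - 2`, where `2` bounds `‖s n‖`, so their tiles stabilise to a
  -- tiling `W`. Undoing the total translation `a` gives the limit of `u`.
  let S : ℕ → TilingSpace Pset := fun n => s n +ᵥ u n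
  have hS1 : ∀ n, Agree (2 ^ n - 2) (S n).1 (S (n + 1)).1 := by
    intro n
    have h := (hA n).vadd (v := s n) (R' := 2 ^ n - 2) (by linarith [hs n])
    rw [vadd_vadd, ← Finset.sum_range_succ] at h
    exact h
  have hS : ∀ n k, n ≤ k → Agree (2 ^ n - 2) (S n).1 (S k).1 := by
    intro n k hnk
    induction k, hnk using Nat.le_induction with
    | base => exact Agree.refl _ _
    | succ k hk ih =>
      exact ih.trans ((hS1 k).mono (by
        have : (2 : ℝ) ^ n ≤ 2 ^ k := pow_le_pow_right₀ one_le_two hk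
        linarith))
  have hlarge : ∀ x : ℝ, ∀ᶠ n : ℕ in atTop, x ≤ 2 ^ n - 2 := fun x => by
    filter_upwards [(tendsto_pow_atTop_atTop_of_one_lt (one_lt_two (α := ℝ))).eventually_ge_atTop
      (x + 2)] with n hn
    linarith
  obtain ⟨W, hW⟩ := exists_tilingSpace_mem_iff_eventually (Pset := Pset)
    (M := fun n => (S n).1.tiles) (fun n => (S n).1.isTileFamily)
    (fun n P hP => (S n).toAbstract_mem hP) fun x => by
      obtain ⟨n, hn⟩ := (hlarge ‖x‖).exists
      obtain ⟨m, hm, hx⟩ := (S n).1.exists_mem x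
      exact ⟨m, hx, eventually_atTop.2 ⟨n, fun k hk =>
        (hS n k hk m ⟨x, hx, by rwa [mem_closedBall_zero_iff]⟩).1 hm⟩⟩
  have hSW : ∀ n, Agree (2 ^ n - 2) W.1 (S n).1 := by
    intro n m hm
    rw [hW]
    constructor
    · intro h
      obtain ⟨k, hk, hnk⟩ := (h.and (eventually_ge_atTop n)).exists
      exact (hS n k hnk m hm).2 hk
    · intro h
      exact eventually_atTop.2 ⟨n, fun k hk => (hS n k hk m hm).1 h⟩
  refine ⟨-a +ᵥ W, ((hb.hasBasis_nhds _).tendsto_right_iff).2 fun N _ => ?_⟩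
  have hpos : (0 : ℝ) < 1 / (N + 1) := by positivity
  filter_upwards [hlarge (N + 1 + ‖a‖), ha.eventually (ball_mem_nhds a hpos)] with n h1 h2
  refine ⟨s n - a, ?_, ?_⟩
  · rw [← dist_eq_norm]
    exact (mem_ball.1 h2).le
  · have h := (hSW n).vadd (v := -a) (R' := N + 1) (by rw [norm_neg]; exact h1)
    have e : (s n - a) +ᵥ (u n).1 = -a +ᵥ (S n).1 := by
      simp only [S, TilingSpace.coe_vadd]
      rw [vadd_vadd, sub_eq_neg_add]
    rw [e]
    exact h

end TileBounds

end Limit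

/-! ### Linear repetitivity -/

section Repetitive

variable {d : ℕ} {Γ : Type*} {Pset : Set (AbstractPattern d Γ)}

/-! ### Inner and outer radii of sets compared with balls -/

theorem radius_le_of_closedBall_subset (hd : 1 ≤ d) {x y : E d} {ρ σ : ℝ} (hρ : 0 ≤ ρ)
    (h : closedBall x ρ ⊆ closedBall y σ) : ρ ≤ σ := by
  have : Nonempty (Fin d) := ⟨⟨0, hd⟩⟩
  obtain ⟨e, he⟩ := exists_norm_eq (E d) hρ
  have h1 := mem_closedBall.1 (h (show x + e ∈ closedBall x ρ by simp [he]))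
  have h2 := mem_closedBall'.1 (h (show x - e ∈ closedBall x ρ by simp [he]))
  have h3 : dist (x + e) (x - e) = 2 * ρ := by
    rw [dist_eq_norm, show x + e - (x - e) = (2 : ℝ) • e by rw [two_smul]; abel, norm_smul, he]
    norm_num
  linarith [dist_triangle (x + e) y (x - e)]

theorem le_outerRadius (hd : 1 ≤ d) {A : Set (E d)} (hA : Bornology.IsBounded A) {x : E d} {ρ : ℝ}
    (hρ : 0 ≤ ρ) (h : closedBall x ρ ⊆ A) : ρ ≤ outerRadius A := by
  refine le_csInf ?_ ?_
  · obtain ⟨σ, hσ⟩ := hA.subset_closedBall (0 : E d)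
    exact ⟨σ, 0, hσ⟩
  · rintro σ ⟨y, hy⟩
    exact radius_le_of_closedBall_subset hd hρ (h.trans hy)

theorem outerRadius_le {A : Set (E d)} (hA : A.Nonempty) {x : E d} {ρ : ℝ}
    (h : A ⊆ closedBall x ρ) : outerRadius A ≤ ρ := by
  refine csInf_le ⟨0, ?_⟩ ⟨x, h⟩
  rintro σ ⟨y, hy⟩
  obtain ⟨z, hz⟩ := hA
  exact dist_nonneg.trans (hy hz)

theorem le_innerRadius (hd : 1 ≤ d) {A : Set (E d)} (hA : Bornology.IsBounded A) {x : E d} {ρ : ℝ}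
    (h : closedBall x ρ ⊆ A) : ρ ≤ innerRadius A := by
  obtain ⟨σ, hσ⟩ := hA.subset_closedBall (0 : E d)
  -- The set of radii also contains all negative numbers, hence the maximum with `0`.
  refine le_csSup ⟨max σ 0, ?_⟩ ⟨x, h⟩
  rintro τ ⟨y, hy⟩
  rcases le_total 0 τ with h0 | h0
  · exact (radius_le_of_closedBall_subset hd h0 (hy.trans hσ)).trans (le_max_left _ _)
  · exact h0.trans (le_max_right _ _)

theorem Pattern.exists_vadd_eq {P Q : Pattern d Γ} (h : P.toAbstract = Q.toAbstract) :
    ∃ v : E d, v +ᵥ Q = P :=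
  Quotient.exact h

namespace TileBounds

variable {r D : ℝ} (hb : TileBounds Pset r D)
include hb

theorem support_patch_subset (T : TilingSpace Pset) (R : ℝ) :
    support (hb.patch T R).tiles ⊆ closedBall 0 (R + D) :=
  Set.iUnion₂_subset fun _ hm => hb.subset_closedBall T hm.1 hm.2

theorem exists_agree_vadd (hd : 1 ≤ d) (hLR : LinearlyRepetitive Pset) :
    ∃ C : ℝ, 0 ≤ C ∧ ∀ R : ℝ, 1 ≤ R → ∀ T S : TilingSpace Pset,
      ∃ t : E d, ‖t‖ ≤ C * R ∧ Agree R T.1 (t +ᵥ S.1) := by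
  obtain ⟨c, hc, hrep⟩ := hLR
  have hD := hb.D_pos
  refine ⟨c * (1 + 2 * D) + D, by positivity, fun R hR T S => ?_⟩
  -- The extra `D` is what `agree_of_subset` demands. The support of `P` lies in a ball of radius `R
  -- + D + D`, which dictates the size of `Q`.
  let P := hb.patch T (R + D)
  let Q := hb.patch S (c * (R + D + D))
  have hPb := hb.support_patch_subset T (R + D)
  have hPc : closedBall 0 (R + D) ⊆ support P.tiles := closedBall_subset_support T.1 _
  have hQb := hb.support_patch_subset S (c * (R + D + D))
  have hQc : closedBall 0 (c * (R + D + D)) ⊆ support Q.tiles := closedBall_subset_support S.1 _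
  have h0 : (0 : E d) ∈ support P.tiles := hPc (mem_closedBall_self (by linarith))
  have hPout : P.toAbstract.rout ≤ R + D + D := outerRadius_le ⟨0, h0⟩ hPb
  have hPout1 : 1 ≤ P.toAbstract.rout := by
    have := le_outerRadius hd (isBounded_closedBall.subset hPb) (by linarith) hPc
    exact le_trans (by linarith) this
  have hQin : c * (R + D + D) ≤ Q.toAbstract.rin :=
    le_innerRadius hd (isBounded_closedBall.subset hQb) hQc
  obtain ⟨P', Q', hP', hQ', hsub⟩ := hrep P.toAbstract (T.toAbstract_mem (Set.sep_subset _ _))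
    hPout1 Q.toAbstract (S.toAbstract_mem (Set.sep_subset _ _))
    ((mul_le_mul_of_nonneg_left hPout hc.le).trans hQin)
  obtain ⟨v, rfl⟩ := Pattern.exists_vadd_eq hP'
  obtain ⟨w, rfl⟩ := Pattern.exists_vadd_eq hQ'
  have hmem : ∀ m ∈ P.tiles, shiftTile (-(-v + w)) m ∈ Q.tiles := by
    intro m hm
    have h1 := mem_shiftTile_image.1 (hsub (Set.mem_image_of_mem (shiftTile v) hm))
    rwa [← shiftTile_add, show -w + v = -(-v + w) by abel] at h1
  refine ⟨-v + w, ?_, ?_⟩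
  -- The tile of `P` over the origin is moved into `Q`, so the translation vector is bounded by the
  -- radius of a ball containing `Q`; `1 ≤ R` absorbs the constants.
  · obtain ⟨m, hm, h0m⟩ := Set.mem_iUnion₂.1 h0
    have h1 : -(-v + w) ∈ support Q.tiles := by
      refine Set.mem_biUnion (hmem m hm) ?_
      have := Set.vadd_mem_vadd_set (a := -(-v + w)) h0m
      rwa [vadd_eq_add, add_zero] at this
    have h2 := mem_closedBall_zero_iff.1 (hQb h1)
    rw [norm_neg] at h2
    refine h2.trans ?_
    nlinarith [mul_nonneg hc.le hD.le]
  · exact hb.agree_of_subset (S := (-v + w) +ᵥ S) fun m hm hmR =>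
      Tiling.mem_vadd.2 (hmem m ⟨hm, hmR⟩).1

theorem compactSpace [Nonempty (TilingSpace Pset)] (hd : 1 ≤ d) (hLR : LinearlyRepetitive Pset) :
    CompactSpace (TilingSpace Pset) := by
  obtain ⟨T₀⟩ := ‹Nonempty (TilingSpace Pset)›
  obtain ⟨C, -, hrep⟩ := hb.exists_agree_vadd hd hLR
  let := hb.uniformSpace
  have := hb.completeSpace
  refine ⟨isCompact_iff_totallyBounded_isComplete.2 ⟨?_, completeSpace_iff_isComplete_univ.1 this⟩⟩
  -- A single orbit provides the finite net: translates of `T₀` by a `1 / (n + 1)`-net of a ball of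
  -- radius `C * (n + 1)`.
  refine hb.hasBasis_uniformity.totallyBounded_iff.2 fun n _ => ?_
  have hpos : (0 : ℝ) < 1 / (n + 1) := by positivity
  obtain ⟨F, -, hF, hcover⟩ := finite_cover_balls_of_compact
    (isCompact_closedBall (0 : E d) (C * (n + 1))) hpos
  refine ⟨(fun y => y +ᵥ T₀) '' F, hF.image _, fun T _ => ?_⟩
  obtain ⟨t, ht, hA⟩ := hrep (n + 1) (by linarith [n.cast_nonneg (α := ℝ)]) T T₀
  obtain ⟨y, hy, hty⟩ := Set.mem_iUnion₂.1 (hcover (mem_closedBall_zero_iff.2 ht))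
  refine Set.mem_biUnion (Set.mem_image_of_mem _ hy) ⟨t - y, ?_, ?_⟩
  · rw [← dist_eq_norm]
    exact (mem_ball.1 hty).le
  · simp only [TilingSpace.coe_vadd]
    rwa [vadd_vadd, sub_add_cancel]

theorem linearlyRecurrent [CompactSpace (TilingSpace Pset)] (hd : 1 ≤ d)
    (hLR : LinearlyRepetitive Pset) : LinearlyRecurrent d (TilingSpace Pset) := by
  obtain ⟨C, hC, hrep⟩ := hb.exists_agree_vadd hd hLR
  refine ⟨2 * C, by positivity, fun f hf ε hε => ?_⟩
  let := hb.uniformSpace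
  have huc := CompactSpace.uniformContinuous_of_continuous hf
  obtain ⟨n, -, hn⟩ := hb.hasBasis_uniformity.mem_iff.1 (huc (dist_mem_uniformity hε))
  refine ⟨n + 1, fun L hL T S => ?_⟩
  have hn0 := n.cast_nonneg (α := ℝ)
  -- The additional `n + 1` leaves agreement on a ball of that radius after any shift of length at
  -- most `L`; as `n + 1 ≤ L`, it costs the factor `2` in the constant.
  obtain ⟨t, ht, hA⟩ := hrep (L + (n + 1)) (by linarith) T S
  refine ⟨t, ht.trans (by nlinarith), fun v hv => ?_⟩
  have hnear : Near (n + 1) (v +ᵥ T).1 (v +ᵥ (t +ᵥ S)).1 :=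
    ⟨0, by rw [norm_zero]; positivity, by
      rw [zero_vadd]
      exact hA.vadd (by linarith)⟩
  exact le_of_lt (hn (show (v +ᵥ T, v +ᵥ (t +ᵥ S)) ∈ _ from hnear))

end TileBounds

end Repetitive

end LRTiling

theorem mainTheorem4 {d : ℕ} (hd : 1 ≤ d) {Γ : Type*}
    (Pset : Set (LRTiling.AbstractPattern d Γ))
    (hadm : LRTiling.Admissible Pset)
    (hne : ∃ P : LRTiling.Pattern d Γ, P.toAbstract ∈ Pset ∧ P.tiles.Nonempty)
    (hLR : LRTiling.LinearlyRepetitive Pset) :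
    ∃ μ : Measure (LRTiling.TilingSpace Pset),
      IsProbabilityMeasure μ ∧
      VAddInvariantMeasure (LRTiling.E d) (LRTiling.TilingSpace Pset) μ ∧
      (∀ ν : Measure (LRTiling.TilingSpace Pset), IsProbabilityMeasure ν →
        VAddInvariantMeasure (LRTiling.E d) (LRTiling.TilingSpace Pset) ν → ν = μ) ∧
      (∀ f : LRTiling.TilingSpace Pset → ℝ, Continuous f →
        Integrable f μ ∧
        (∀ (B : LRTiling.Box d) (T : LRTiling.TilingSpace Pset),
          IntegrableOn (fun t : LRTiling.E d => f (-t +ᵥ T)) B.toSet volume) ∧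
        (∀ ε : ℝ, 0 < ε → ∃ R : ℝ, ∀ B : LRTiling.Box d, R ≤ B.width →
          ∀ T : LRTiling.TilingSpace Pset,
            |(⨍ t in B.toSet, f (-t +ᵥ T)) - ∫ S, f S ∂μ| ≤ ε)) := by
  obtain ⟨r, D, hb⟩ := hadm.exists_tileBounds
  have := hadm.nonempty_tilingSpace hne
  have := hb.metrizableSpace
  have := hb.continuousVAdd
  have := hb.compactSpace hd hLR
  obtain ⟨μ, hμ, hinv, huniq, hlim⟩ :=
    LRTiling.uniquelyErgodic_of_linearlyRecurrent hd (hb.linearlyRecurrent hd hLR)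
  -- `Box.unif` is the normalised restricted volume by which the set average is defined, so `hlim`
  -- applies definitionally.
  refine ⟨μ, hμ, hinv, huniq, fun f hf => ⟨LRTiling.integrable_of_continuous hf μ, fun B T => ?_,
    hlim f hf⟩⟩
  obtain ⟨C, hC⟩ := LRTiling.exists_abs_le_of_continuous hf
  have : IsFiniteMeasure (volume.restrict B.toSet) := ⟨by simpa using B.volume_ne_top.lt_top⟩
  exact LRTiling.integrable_orbit hf hC _ T
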